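/- Let $a,b,A\in\mathbb{C}$, $0<\lambda<\infty$, $\mu<1$, and $\zeta\in\mathbb{C}$ with $|\zeta|=1$, $\zeta\neq 1$. Let $\theta\in(0,\pi)$ be such that the sectors $|\arg z|\le\theta$ and $|\arg(z/\zeta)|\le\theta$ (vertex $z=0$ excluded, principal arguments) are disjoint. Let $f$ be an entire function such that, as $|z|\to\infty$, $$ f(z)=\begin{cases} z^a\exp(z^\lambda)\,[1+o(1)] & \text{for } |\arg z|\le\theta,\\ A(z/\zeta)^b\exp\big((z/\zeta)^\lambda\big)\,[1+o(1)] & \text{for } |\arg(z/\zeta)|\le\theta,\\ O\big(\exp(\mu|z|^\lambda)\big) & \text{otherwise,} \end{cases} $$ each estimate holding uniformly in its region, with principal powers. Put $$ p_n(z)=\sum_{k=0}^{n}\frac{f^{(k)}(0)}{k!}z^k,\qquad r_n=\Big(\frac n\lambda\Big)^{1/\lambda},\qquad \operatorname{erfc}(z)=\frac{2}{\sqrt\pi}\int_z^{\infty}e^{-s^2}\,ds, $$ where the integral is taken along the horizontal ray from $z$ to $z+\infty$. Then $$ \lim_{n\to\infty}\frac{p_{n-1}\big(r_n(1+w/\sqrt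 n)\big)}{f\big(r_n(1+w/\sqrt n)\big)}=\frac12\operatorname{erfc}\big(w\sqrt{\lambda/2}\big) $$ uniformly for $w$ in every compact subset of $\{\operatorname{Re}w<0\}$ if and only if $\operatorname{Re}b-\operatorname{Re}a<\lambda/2$. -/

import Mathlib

open Filter Topology Asymptotics

noncomputable section

namespace CornerLimit

/-- The closed sector `|arg (z / ζ)| ≤ θ` with its vertex `0` removed
(the argument is the principal one, and `0` has none). -/
def sector (θ : ℝ) (ζ : ℂ) : Set ℂ :=
  {z : ℂ | z ≠ 0 ∧ |Complex.arg (z / ζ)| ≤ θ}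

/-- The filter `|z| → ∞` with `z` restricted to `S`. An asymptotic relation along this filter is
one that holds uniformly in `S` as `|z| → ∞`. -/
def atInftyWithin (S : Set ℂ) : Filter ℂ :=
  Bornology.cobounded ℂ ⊓ 𝓟 S

/-- `f` is entire with two directions of maximal exponential growth, `1` and `ζ`:
`f z = z ^ a * exp (z ^ lam) * (1 + o(1))` in the sector about `1`,
`f z = A * (z / ζ) ^ b * exp ((z / ζ) ^ lam) * (1 + o(1))` in the sector about `ζ`, and
`f z = O (exp (μ * |z| ^ lam))` elsewhere, as `|z| → ∞`, each uniformly in its region.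
All powers are principal. -/
structure HasTwoDirections (f : ℂ → ℂ) (a b A : ℂ) (lam μ : ℝ) (ζ : ℂ) (θ : ℝ) : Prop where
  entire : Differentiable ℂ f
  first : f ~[atInftyWithin (sector θ 1)]
    fun z => z ^ a * Complex.exp (z ^ (lam : ℂ))
  second : f ~[atInftyWithin (sector θ ζ)]
    fun z => A * (z / ζ) ^ b * Complex.exp ((z / ζ) ^ (lam : ℂ))
  otherwise : f =O[atInftyWithin (sector θ 1 ∪ sector θ ζ)ᶜ]
    fun z => Real.exp (μ * ‖z‖ ^ lam)

/-- The `m`-th partial sum `∑_{k=0}^m f⁽ᵏ⁾(0) / k! * z ^ k` of the Maclaurin series of `f`. -/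
def partialSum (f : ℂ → ℂ) (m : ℕ) (z : ℂ) : ℂ :=
  ∑ k ∈ Finset.range (m + 1), iteratedDeriv k f 0 / (k.factorial : ℂ) * z ^ k

/-- The scaling radius `r_n = (n / lam) ^ (1 / lam)`. -/
def radius (lam : ℝ) (n : ℕ) : ℝ := ((n : ℝ) / lam) ^ (1 / lam)

/-- The point `r_n (1 + w / √n)`. -/
def cornerPoint (lam : ℝ) (n : ℕ) (w : ℂ) : ℂ :=
  (radius lam n : ℂ) * (1 + w / (Real.sqrt n : ℂ))

/-- The complementary error function `2 / √π * ∫_z^∞ exp (-s ^ 2) ds`, integrated along the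
horizontal ray `s = z + t`, `t > 0`. -/
def erfc (z : ℂ) : ℂ :=
  2 / (Real.sqrt Real.pi : ℂ) * ∫ t in Set.Ioi (0 : ℝ), Complex.exp (-(z + (t : ℂ)) ^ 2)

end CornerLimit

end

/-! By Cauchy's formula, `p_{n-1}(z) = f(z) - z^n/(2πi) ∮ f(t) t^{-n} (t-z)^{-1} dt` over `|t| =
r_n`; the condition `Re w < 0` puts the corner point `z` inside this circle. Dividing by `f(z)`
leaves one integral to estimate. At `t = r_n e^{iφ}` the exponent is `(n/λ) e^{iλφ} - inφ`, because
`r_n^λ = n/λ`; it is stationary at `φ = 0`, where the integrand has a Gaussian peak of width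
`n^{-1/2}`.

In the sector about `1`, the point `z` is at relative distance of order `n^{-1/2}` from the peak.
The Cauchy kernel grows like `√n` and compensates the width of the peak, so the contribution tends
to `∫ (is-w)^{-1} e^{-λs²/2} ds` (`tendsto_first_sector`). With the factor from `z^n / f(z)`
(`tendsto_cornerPoint_pow_div`), this is the `erfc` term (`one_sub_gaussian_cauchy_integral`).

In the sector about `ζ` the kernel stays bounded, so the width is not compensated: the contribution
is `r_n^{b-a} ζ^{-n} n^{-1/2} T_n` with `T_n` bounded, of modulus `r_n^{Re b - Re a - λ/2} |T_n| /
√λ`. The remaining arcs are exponentially small since `μ < 1`. Sufficiency follows at once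
(`exists_remainder_decomposition`, `norm_sector_ratio`).

For necessity, `T_n` must not tend to zero. For large `λ` a sector can contain several directions
`2πm/λ` in which `exp(z^λ)` is maximal, so `T_n` is asymptotic to a sum `∑ c_m e^{-2πimn/λ}` with
`c_0 ≠ 0`. The directions in the sector are distinct modulo `2π`, so a Cesàro mean isolates `c_0`
(`eq_zero_of_tendsto_expSum`).

Asymptotic statements are made along an arbitrary filter with `n → ∞` and `w → w₀`. A fixed `w`
serves necessity; joint convergence in `(n, w)` yields uniformity on compact sets. -/

namespace CornerLimit

open MeasureTheory Complex

/-! ### Cauchy's formula for the remainder -/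

/-- The remainder of the Maclaurin expansion as an integral over a circle. -/
theorem partialSum_eq_sub_circleIntegral {f : ℂ → ℂ} (hf : Differentiable ℂ f) {r : ℝ} {z : ℂ}
    (hz : ‖z‖ < r) {n : ℕ} (hn : 0 < n) :
    partialSum f (n - 1) z = f z -
      z ^ n * ((2 * Real.pi * I)⁻¹ * ∮ t in C(0, r), (t ^ n)⁻¹ * (t - z)⁻¹ * f t) := by
  have hr : 0 < r := (norm_nonneg z).trans_lt hz
  have hne : ∀ t ∈ Metric.sphere (0 : ℂ) r, t ≠ 0 ∧ t - z ≠ 0 := by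
    intro t ht
    have ht' : ‖t‖ = r := by simpa using ht
    refine ⟨fun h => by simp [h] at ht'; linarith, fun h => ?_⟩
    rw [sub_eq_zero] at h
    rw [h] at ht'; linarith
  have hcoef : ∀ k, iteratedDeriv k f 0 / (k.factorial : ℂ) =
      (2 * Real.pi * I)⁻¹ * ∮ t in C(0, r), (t ^ (k + 1))⁻¹ * f t := by
    intro k
    have := DifferentiableOn.circleIntegral_one_div_sub_center_pow_smul (c := 0) hr k
      (hf.differentiableOn (s := Metric.closedBall 0 r))
    simp only [sub_zero, one_div, smul_eq_mul] at this
    rw [this]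
    have := two_pi_I_ne_zero
    field_simp
  have hval : f z = (2 * Real.pi * I)⁻¹ * ∮ t in C(0, r), (t - z)⁻¹ * f t := by
    have := two_pi_I_inv_smul_circleIntegral_sub_inv_smul_of_differentiable_on_off_countable
      (s := ∅) (c := 0) (R := r) (w := z) (f := f) Set.countable_empty (by simpa using hz)
      hf.continuous.continuousOn (fun x _ => hf x)
    simpa [smul_eq_mul] using this.symm
  have hci1 : ∀ k : ℕ, CircleIntegrable (fun t => z ^ k * ((t ^ (k + 1))⁻¹ * f t)) 0 r := by
    intro k
    apply ContinuousOn.circleIntegrable hr.le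
    refine continuousOn_const.mul (ContinuousOn.mul (ContinuousOn.inv₀ (by fun_prop) ?_)
      hf.continuous.continuousOn)
    intro t ht
    exact pow_ne_zero _ (hne t ht).1
  have hci2 : CircleIntegrable (fun t => z ^ n * ((t ^ n)⁻¹ * (t - z)⁻¹ * f t)) 0 r := by
    apply ContinuousOn.circleIntegrable hr.le
    refine continuousOn_const.mul (ContinuousOn.mul (ContinuousOn.mul
      (ContinuousOn.inv₀ (by fun_prop) ?_) (ContinuousOn.inv₀ (by fun_prop) ?_))
      hf.continuous.continuousOn)
    · intro t ht
      exact pow_ne_zero _ (hne t ht).1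
    · intro t ht
      exact (hne t ht).2
  have hsum : partialSum f (n - 1) z = (2 * Real.pi * I)⁻¹ *
      ∮ t in C(0, r), ∑ k ∈ Finset.range n, z ^ k * ((t ^ (k + 1))⁻¹ * f t) := by
    rw [circleIntegral.integral_fun_sum (fun k _ => hci1 k)]
    unfold partialSum
    rw [Nat.sub_add_cancel hn, Finset.mul_sum]
    refine Finset.sum_congr rfl fun k _ => ?_
    rw [circleIntegral.integral_const_mul, hcoef]
    ring
  have hkey : (∮ t in C(0, r), (t - z)⁻¹ * f t) =
      ∮ t in C(0, r), ((∑ k ∈ Finset.range n, z ^ k * ((t ^ (k + 1))⁻¹ * f t)) +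
        z ^ n * ((t ^ n)⁻¹ * (t - z)⁻¹ * f t)) := by
    refine circleIntegral.integral_congr hr.le fun t ht => ?_
    obtain ⟨h1, h2⟩ := hne t ht
    -- The finite geometric expansion of the Cauchy kernel with exact remainder: its sum gives the
    -- Taylor terms, its last term the remainder.
    have : ∀ m : ℕ, (t - z)⁻¹ = (∑ k ∈ Finset.range m, z ^ k * (t ^ (k + 1))⁻¹) +
        z ^ m * ((t ^ m)⁻¹ * (t - z)⁻¹) := by
      intro m
      induction m with
      | zero => simp
      | succ m ih =>
        rw [Finset.sum_range_succ]
        refine ih.trans ?_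
        have h3 : z ^ m * ((t ^ m)⁻¹ * (t - z)⁻¹) = z ^ m * (t ^ (m + 1))⁻¹ +
            z ^ (m + 1) * ((t ^ (m + 1))⁻¹ * (t - z)⁻¹) := by
          field_simp
          ring
        rw [h3, add_assoc]
    refine (congrArg (· * f t) (this n)).trans ?_
    simp only [add_mul, Finset.sum_mul]
    congr 1
    · exact Finset.sum_congr rfl fun k _ => by ring
    · ring
  rw [hsum, hval, hkey, circleIntegral.integral_add, circleIntegral.integral_const_mul]
  · ring
  · exact CircleIntegrable.fun_sum _ fun k _ => hci1 k
  · exact hci2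

/-- By periodicity the starting angle `c` is free, so the circle can later be cut along the edges of
the sectors. -/
theorem partialSum_eq_sub_integral {f : ℂ → ℂ} (hf : Differentiable ℂ f) {r : ℝ} {z : ℂ}
    (hz : ‖z‖ < r) {n : ℕ} (hn : 0 < n) (c : ℝ) :
    partialSum f (n - 1) z = f z - z ^ n * ((2 * Real.pi : ℂ)⁻¹ *
      ∫ φ in c..c + 2 * Real.pi, f (r * exp (φ * I)) * ((r * exp (φ * I)) ^ n)⁻¹ *
        (r * exp (φ * I) / (r * exp (φ * I) - z))) := by
  rw [partialSum_eq_sub_circleIntegral hf hz hn, circleIntegral]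
  have hper : Function.Periodic (fun φ : ℝ => f (r * exp (φ * I)) * ((r * exp (φ * I)) ^ n)⁻¹ *
        (r * exp (φ * I) / (r * exp (φ * I) - z))) (2 * Real.pi) := by
    intro φ
    have : exp (((φ + 2 * Real.pi : ℝ) : ℂ) * I) = exp (φ * I) := by
      push_cast
      rw [add_mul, exp_add, exp_two_pi_mul_I, mul_one]
    simp only [this]
  rw [hper.intervalIntegral_add_eq c 0, zero_add, mul_inv, mul_assoc _ I⁻¹,
    ← intervalIntegral.integral_const_mul]
  congr 3
  refine intervalIntegral.integral_congr fun φ _ => ?_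
  simp only [deriv_circleMap, circleMap_zero, smul_eq_mul]
  field_simp

/-! ### The complementary error function -/

theorem erfc_add_erfc_neg (z : ℂ) : erfc z + erfc (-z) = 2 := by
  have hre : (-1 : ℂ).re < 0 := by simp
  have hexp : ∀ u : ℂ, ∀ t : ℝ, exp (-(u + (t : ℂ)) ^ 2) =
      exp ((-1 : ℂ) * (t : ℂ) ^ 2 + (-2 * u) * t + (-u ^ 2)) := fun u t => by congr 1; ring
  have hint : ∀ u : ℂ, Integrable (fun t : ℝ => exp (-(u + (t : ℂ)) ^ 2)) := by
    intro u
    simp_rw [hexp]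
    exact integrable_cexp_quadratic' hre _ _
  have h1 : ∫ t : ℝ, exp (-(z + (t : ℂ)) ^ 2) = (Real.sqrt Real.pi : ℂ) := by
    simp_rw [hexp]
    rw [integral_cexp_quadratic hre]
    have : -z ^ 2 - (-2 * z) ^ 2 / (4 * (-1)) = 0 := by ring
    rw [this, exp_zero, mul_one, Real.sqrt_eq_rpow, ofReal_cpow Real.pi_pos.le]
    simp
  have h2 : ∫ t in Set.Ioi (0 : ℝ), exp (-(-z + (t : ℂ)) ^ 2) =
      ∫ t in Set.Iic (0 : ℝ), exp (-(z + (t : ℂ)) ^ 2) := by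
    have := integral_comp_neg_Ioi (0 : ℝ) (fun t : ℝ => exp (-(z + (t : ℂ)) ^ 2))
    rw [neg_zero] at this
    rw [← this]
    congr 1
    ext t
    congr 1
    push_cast
    ring
  have h3 := intervalIntegral.integral_Iic_add_Ioi (b := (0 : ℝ)) (hint z).integrableOn (hint z).integrableOn
  have hpi : (Real.sqrt Real.pi : ℂ) ≠ 0 := by
    exact_mod_cast (Real.sqrt_pos.2 Real.pi_pos).ne'
  unfold erfc
  rw [h2, ← mul_add, add_comm (∫ t in Set.Ioi (0 : ℝ), exp (-(z + (t : ℂ)) ^ 2)), h3, h1]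
  field_simp

/-- The Cauchy-type integral of a Gaussian over the imaginary axis in terms of `erfc`. -/
theorem one_sub_gaussian_cauchy_integral {lam : ℝ} (hlam : 0 < lam) {w : ℂ} (hw : w.re < 0) :
    1 - exp (-(lam * w ^ 2 / 2)) * ((2 * Real.pi : ℂ)⁻¹ *
      ∫ s : ℝ, (s * I - w)⁻¹ * exp (-(lam * s ^ 2 / 2))) =
    1 / 2 * erfc (w * (Real.sqrt (lam / 2) : ℂ)) := by
  have hlam' : (lam : ℂ) ≠ 0 := by exact_mod_cast hlam.ne'
  have hsq : (Real.sqrt (lam / 2) : ℂ) ^ 2 = lam / 2 := by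
    rw [← ofReal_pow, Real.sq_sqrt (by positivity)]; push_cast; rfl
  have hs0 : (Real.sqrt (lam / 2) : ℂ) ≠ 0 := by
    exact_mod_cast (Real.sqrt_pos.2 (by positivity : 0 < lam / 2)).ne'
  -- Since `Re w < 0`, the Cauchy kernel is a Laplace transform; Fubini then leaves a Gaussian
  -- integral in `s`.
  have hinner : ∀ s : ℝ, (s * I - w)⁻¹ * exp (-(lam * s ^ 2 / 2)) =
      ∫ t in Set.Ioi (0 : ℝ), exp ((w - s * I) * t) * exp (-(lam * s ^ 2 / 2)) := by
    intro s
    rw [integral_mul_const, integral_exp_mul_complex_Ioi (by simpa using hw)]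
    congr 1
    rw [ofReal_zero, mul_zero, exp_zero, neg_div, ← div_neg, neg_sub, one_div]
  have hintg : Integrable (Function.uncurry fun (s t : ℝ) =>
      exp ((w - s * I) * t) * exp (-(lam * s ^ 2 / 2)))
      (volume.prod (volume.restrict (Set.Ioi (0 : ℝ)))) := by
    have h1 : Integrable (fun s : ℝ => Real.exp (-(lam / 2) * s ^ 2)) :=
      integrable_exp_neg_mul_sq (by positivity)
    have h2 : Integrable (fun t : ℝ => Real.exp (w.re * t)) (volume.restrict (Set.Ioi (0 : ℝ))) :=
      integrableOn_exp_mul_Ioi hw 0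
    refine (h1.mul_prod h2).mono' (by apply Continuous.aestronglyMeasurable; fun_prop) ?_
    refine Eventually.of_forall fun ⟨s, t⟩ => le_of_eq ?_
    simp only [Function.uncurry, norm_mul, norm_exp]
    rw [mul_comm]
    congr 2
    · have : (-((lam : ℂ) * (s : ℂ) ^ 2 / 2)) = ((-(lam / 2) * s ^ 2 : ℝ) : ℂ) := by
        push_cast; ring
      rw [this, ofReal_re]
    · simp
  have hswap : ∫ s : ℝ, (s * I - w)⁻¹ * exp (-(lam * s ^ 2 / 2)) =
      ∫ t in Set.Ioi (0 : ℝ), ((Real.pi / (lam / 2 : ℂ)) ^ (1 / 2 : ℂ)) *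
        exp (w * t - t ^ 2 / (2 * lam)) := by
    simp_rw [hinner]
    rw [integral_integral_swap hintg]
    congr 1
    ext t
    have hb : (-(lam / 2) : ℂ).re < 0 := by
      have : (-(lam / 2) : ℂ) = ((-(lam / 2) : ℝ) : ℂ) := by push_cast; rfl
      rw [this, ofReal_re]; linarith
    have : ∀ s : ℝ, exp ((w - s * I) * t) * exp (-(lam * s ^ 2 / 2)) =
        exp ((-(lam / 2) : ℂ) * s ^ 2 + (-(I * t)) * s + w * t) := by
      intro s; rw [← exp_add]; congr 1; ring
    simp_rw [this]
    rw [integral_cexp_quadratic hb, neg_neg]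
    congr 2
    field_simp
    rw [I_sq]; ring
  -- Completing the square: the substitution `t ↦ 2√(λ/2) t` turns the exponent into that of `erfc
  -- (-w√(λ/2))`.
  have hsub : ∫ t in Set.Ioi (0 : ℝ), exp (-(lam * w ^ 2 / 2)) * exp (w * t - t ^ 2 / (2 * lam)) =
      (2 * Real.sqrt (lam / 2) : ℂ) * ∫ t in Set.Ioi (0 : ℝ),
        exp (-(-(w * (Real.sqrt (lam / 2) : ℂ)) + (t : ℂ)) ^ 2) := by
    have hk : 0 < 2 * Real.sqrt (lam / 2) := by positivity
    have := integral_comp_mul_left_Ioi (fun t : ℝ => exp (-(lam * w ^ 2 / 2)) *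
      exp (w * t - t ^ 2 / (2 * lam))) 0 hk
    rw [mul_zero] at this
    have h2 := congrArg (fun x => (2 * Real.sqrt (lam / 2) : ℂ) * x) this
    simp only [Complex.real_smul] at h2
    push_cast at h2
    rw [mul_inv_cancel_left₀ (by simpa using hs0)] at h2
    rw [← h2]
    congr 2
    ext t
    rw [← exp_add]
    congr 1
    have e : (2 * (Real.sqrt (lam / 2) : ℂ) * t) ^ 2 / (2 * lam) = t ^ 2 := by
      rw [mul_pow, mul_pow, hsq]; field_simp
    have e2 : (lam : ℂ) = 2 * (Real.sqrt (lam / 2) : ℂ) ^ 2 := by rw [hsq]; ring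
    rw [e]
    conv_lhs => rw [e2]
    ring
  have hconst : (2 * Real.pi : ℂ)⁻¹ * ((Real.pi / (lam / 2 : ℂ)) ^ (1 / 2 : ℂ)) *
      (2 * Real.sqrt (lam / 2) : ℂ) = 1 / (Real.sqrt Real.pi : ℂ) := by
    have e1 : ((Real.pi / (lam / 2 : ℂ)) ^ (1 / 2 : ℂ)) =
        ((Real.sqrt Real.pi / Real.sqrt (lam / 2) : ℝ) : ℂ) := by
      rw [← Real.sqrt_div Real.pi_pos.le, Real.sqrt_eq_rpow, ofReal_cpow (by positivity)]
      push_cast; rfl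
    have e2 : (Real.pi : ℂ) = (Real.sqrt Real.pi : ℂ) ^ 2 := by
      rw [← ofReal_pow, Real.sq_sqrt Real.pi_pos.le]
    have e3 : (Real.sqrt Real.pi : ℂ) ≠ 0 := by
      exact_mod_cast (Real.sqrt_pos.2 Real.pi_pos).ne'
    rw [e1, e2]
    push_cast
    field_simp
  have herfc : exp (-(lam * w ^ 2 / 2)) * ((2 * Real.pi : ℂ)⁻¹ *
      ∫ s : ℝ, (s * I - w)⁻¹ * exp (-(lam * s ^ 2 / 2))) =
      1 / 2 * erfc (-(w * (Real.sqrt (lam / 2) : ℂ))) := by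
    rw [hswap, integral_const_mul]
    rw [integral_const_mul] at hsub
    calc _ = (2 * Real.pi : ℂ)⁻¹ * ((Real.pi / (lam / 2 : ℂ)) ^ (1 / 2 : ℂ)) *
          (exp (-(lam * w ^ 2 / 2)) * ∫ t in Set.Ioi (0 : ℝ), exp (w * t - t ^ 2 / (2 * lam))) := by
            ring
      _ = _ := by
        rw [hsub, ← mul_assoc, hconst, erfc]; ring
  rw [herfc]
  linear_combination (-1 / 2 : ℂ) * erfc_add_erfc_neg (w * (Real.sqrt (lam / 2) : ℂ))

/-! ### Laplace's method -/

theorem tendsto_div_sqrt {ι : Type*} {l : Filter ι} {N : ι → ℝ} (hN : Tendsto N l atTop)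
    {v : ι → ℂ} {c : ℂ} (hv : Tendsto v l (𝓝 c)) :
    Tendsto (fun i => v i / (Real.sqrt (N i) : ℂ)) l (𝓝 0) := by
  have h1 : Tendsto (fun i => (Real.sqrt (N i))⁻¹) l (𝓝 0) :=
    (Real.tendsto_sqrt_atTop.comp hN).inv_tendsto_atTop
  have h2 : Tendsto (fun i => (((Real.sqrt (N i))⁻¹ : ℝ) : ℂ)) l (𝓝 0) := by
    have := (continuous_ofReal.tendsto 0).comp h1
    rwa [ofReal_zero] at this
  simpa [div_eq_mul_inv] using hv.mul h2

/-- Second-order Taylor expansion at scale `N^{-1/2}`. It governs the Laplace kernel, the ratio `z^n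
/ f(z)` and the Cauchy kernel near the peak. -/
theorem tendsto_mul_exp_sub_one_sub {ι : Type*} {l : Filter ι} {N : ι → ℝ}
    (hN : Tendsto N l atTop) {v : ι → ℂ} {c : ℂ}
    (hv : Tendsto (fun i => (Real.sqrt (N i) : ℂ) * v i) l (𝓝 c)) :
    Tendsto (fun i => (N i : ℂ) * (exp (v i) - 1 - v i)) l (𝓝 (c ^ 2 / 2)) := by
  have hpos : ∀ᶠ i in l, 0 < N i := hN.eventually_gt_atTop 0
  have hsq : ∀ i, 0 < N i → (Real.sqrt (N i) : ℂ) ^ 2 = N i := fun i hi => by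
    rw [← ofReal_pow, Real.sq_sqrt hi.le]
  have hv0 : Tendsto v l (𝓝 0) := by
    refine (tendsto_div_sqrt hN hv).congr' ?_
    filter_upwards [hpos] with i hi
    have : (Real.sqrt (N i) : ℂ) ≠ 0 := by exact_mod_cast (Real.sqrt_pos.2 hi).ne'
    field_simp
  have h1 : Tendsto (fun i => ((Real.sqrt (N i) : ℂ) * v i) ^ 2 / 2) l (𝓝 (c ^ 2 / 2)) :=
    (hv.pow 2).div_const 2
  have h2 : Tendsto (fun i => (N i : ℂ) * (exp (v i) - 1 - v i) -
      ((Real.sqrt (N i) : ℂ) * v i) ^ 2 / 2) l (𝓝 0) := by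
    have hb : Tendsto (fun i => ‖(Real.sqrt (N i) : ℂ) * v i‖ ^ 2 * ‖v i‖) l (𝓝 0) := by
      simpa using (hv.norm.pow 2).mul hv0.norm
    refine squeeze_zero_norm' ?_ hb
    have hle : ∀ᶠ i in l, ‖v i‖ ≤ 1 := by
      have := hv0.norm
      rw [norm_zero] at this
      exact this.eventually_le_const one_pos
    filter_upwards [hpos, hle] with i hi hle
    have hexp := Complex.exp_bound hle (n := 3) (by norm_num)
    have e : (N i : ℂ) * (exp (v i) - 1 - v i) - ((Real.sqrt (N i) : ℂ) * v i) ^ 2 / 2 =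
        (N i : ℂ) * (exp (v i) - ∑ m ∈ Finset.range 3, v i ^ m / (m.factorial : ℂ)) := by
      rw [mul_pow, hsq i hi]
      simp [Finset.sum_range_succ, Nat.factorial]
      ring
    rw [e, norm_mul, norm_mul, mul_pow]
    have e2 : ‖(Real.sqrt (N i) : ℂ)‖ ^ 2 = ‖(N i : ℂ)‖ := by rw [← norm_pow, hsq i hi]
    rw [e2, mul_assoc]
    gcongr
    refine hexp.trans ?_
    have : ((Nat.succ 3 : ℕ) : ℝ) * (((Nat.factorial 3 : ℕ) : ℝ) * ((3 : ℕ) : ℝ))⁻¹ ≤ 1 := by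
      norm_num [Nat.factorial]
    calc _ ≤ ‖v i‖ ^ 3 * 1 := by gcongr
      _ = _ := by ring
  simpa using h2.add h1

/-- The normalised kernel `exp (N / lam * (exp (i lam φ) - 1 - i lam φ))` of Laplace's method. -/
noncomputable def laplaceKernel (lam N φ : ℝ) : ℂ :=
  exp ((N / lam : ℂ) * (exp (lam * φ * I) - 1 - lam * φ * I))

theorem continuous_laplaceKernel (lam N : ℝ) : Continuous (laplaceKernel lam N) := by
  unfold laplaceKernel; fun_prop

theorem norm_laplaceKernel (lam N φ : ℝ) :
    ‖laplaceKernel lam N φ‖ = Real.exp (-(N / lam * (1 - Real.cos (lam * φ)))) := by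
  have h : ((N / lam : ℂ) * (exp (lam * φ * I) - 1 - lam * φ * I)) =
      ((N / lam : ℝ) : ℂ) * (exp ((lam * φ : ℝ) * I) - 1 - (lam * φ : ℝ) * I) := by
    push_cast; rfl
  rw [laplaceKernel, norm_exp, h, re_ofReal_mul, sub_re, sub_re, exp_ofReal_mul_I_re,
    re_ofReal_mul, I_re, one_re]
  congr 1; ring

/-- The inequality `cos x ≤ 1 - 2x²/π²` holds on all of `[-π, π]`, so one Gaussian bound covers a
whole period and no separate tail estimate is needed. -/
theorem norm_laplaceKernel_le {lam N φ : ℝ} (hlam : 0 < lam) (hN : 0 ≤ N)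
    (hφ : |φ| ≤ Real.pi / lam) :
    ‖laplaceKernel lam N φ‖ ≤ Real.exp (-(2 * lam / Real.pi ^ 2 * (N * φ ^ 2))) := by
  rw [norm_laplaceKernel]
  have h : |lam * φ| ≤ Real.pi := by
    rw [abs_mul, abs_of_pos hlam]
    rwa [le_div_iff₀' hlam] at hφ
  have := Real.cos_le_one_sub_mul_cos_sq h
  apply Real.exp_le_exp.2
  rw [neg_le_neg_iff]
  calc 2 * lam / Real.pi ^ 2 * (N * φ ^ 2)
      = N / lam * (2 / Real.pi ^ 2 * (lam * φ) ^ 2) := by field_simp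
    _ ≤ _ := by gcongr; linarith

/-- **Laplace's method** for one peak. -/
theorem tendsto_laplace_peak {ι : Type*} {l : Filter ι} [l.IsCountablyGenerated] {lam : ℝ}
    (hlam : 0 < lam) {N : ι → ℝ} (hN : Tendsto N l atTop) {G : ι → ℝ → ℂ} {L : ℝ → ℂ} {C : ℝ}
    (hG : ∀ᶠ i in l, Measurable (G i)) (hC : ∀ᶠ i in l, ∀ φ, ‖G i φ‖ ≤ C)
    (hL : ∀ s : ℝ, Tendsto (fun i => G i (s / Real.sqrt (N i))) l (𝓝 (L s))) :
    Tendsto (fun i => (Real.sqrt (N i) : ℂ) *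
      ∫ φ in (-(Real.pi / lam))..(Real.pi / lam), G i φ * laplaceKernel lam (N i) φ) l
      (𝓝 (∫ s : ℝ, L s * exp (-(lam * s ^ 2 / 2)))) := by
  set J : Set ℝ := Set.Ioc (-(Real.pi / lam)) (Real.pi / lam) with hJ
  have hJpos : 0 < Real.pi / lam := by positivity
  have hpos : ∀ᶠ i in l, 0 < N i := hN.eventually_gt_atTop 0
  -- The substitution `φ = s/√N` turns the integral into one over the line, ready for dominated
  -- convergence.
  have heq : ∀ᶠ i in l, ∫ s : ℝ, J.indicator (fun φ => G i φ * laplaceKernel lam (N i) φ)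
      (s / Real.sqrt (N i)) = (Real.sqrt (N i) : ℂ) *
      ∫ φ in (-(Real.pi / lam))..(Real.pi / lam), G i φ * laplaceKernel lam (N i) φ := by
    filter_upwards [hpos] with i hi
    rw [Measure.integral_comp_div, abs_of_pos (Real.sqrt_pos.2 hi),
      integral_indicator measurableSet_Ioc, intervalIntegral.integral_of_le (by linarith)]
    rw [Complex.real_smul]
  refine Tendsto.congr' heq ?_
  refine tendsto_integral_filter_of_dominated_convergence
    (fun s => C * Real.exp (-(2 * lam / Real.pi ^ 2) * s ^ 2)) ?_ ?_ ?_ ?_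
  · filter_upwards [hG] with i hi
    have hm : Measurable (J.indicator (fun φ => G i φ * laplaceKernel lam (N i) φ)) :=
      (hi.mul (continuous_laplaceKernel _ _).measurable).indicator measurableSet_Ioc
    exact (hm.comp (measurable_id.div_const _)).aestronglyMeasurable
  · filter_upwards [hC, hpos] with i hi hi0
    refine Eventually.of_forall fun s => ?_
    have hC0 : 0 ≤ C := (norm_nonneg _).trans (hi 0)
    by_cases hs : s / Real.sqrt (N i) ∈ J
    · rw [Set.indicator_of_mem hs, norm_mul]
      refine mul_le_mul (hi _) ?_ (norm_nonneg _) hC0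
      refine (norm_laplaceKernel_le hlam hi0.le (abs_le.2 ⟨hs.1.le, hs.2⟩)).trans (le_of_eq ?_)
      congr 1
      rw [div_pow, Real.sq_sqrt hi0.le]
      field_simp
    · rw [Set.indicator_of_notMem hs, norm_zero]
      positivity
  · exact (integrable_exp_neg_mul_sq (by positivity)).const_mul C
  · refine Eventually.of_forall fun s => ?_
    have hsv : Tendsto (fun i => s / Real.sqrt (N i)) l (𝓝 0) :=
      (Real.tendsto_sqrt_atTop.comp hN).const_div_atTop s
    have hmem : ∀ᶠ i in l, s / Real.sqrt (N i) ∈ J :=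
      hsv.eventually (Ioc_mem_nhds (by linarith) hJpos)
    have hk : Tendsto (fun i => laplaceKernel lam (N i) (s / Real.sqrt (N i))) l
        (𝓝 (exp (-(lam * s ^ 2 / 2)))) := by
      unfold laplaceKernel
      refine (continuous_exp.tendsto _).comp ?_
      have h1 : Tendsto (fun i => (Real.sqrt (N i) : ℂ) *
          (lam * (s / Real.sqrt (N i) : ℝ) * I)) l (𝓝 (lam * s * I)) := by
        refine tendsto_const_nhds.congr' ?_
        filter_upwards [hpos] with i hi
        have : (Real.sqrt (N i) : ℂ) ≠ 0 := by exact_mod_cast (Real.sqrt_pos.2 hi).ne'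
        push_cast
        field_simp
      have h2 := (tendsto_mul_exp_sub_one_sub hN h1).mul_const (lam : ℂ)⁻¹
      have e : (lam * s * I : ℂ) ^ 2 / 2 * (lam : ℂ)⁻¹ = -(lam * s ^ 2 / 2) := by
        have : (lam : ℂ) ≠ 0 := by exact_mod_cast hlam.ne'
        rw [mul_pow, I_sq]; field_simp
      rw [e] at h2
      refine h2.congr fun i => ?_
      ring
    refine ((hL s).mul hk).congr' ?_
    filter_upwards [hmem] with i hi
    rw [Set.indicator_of_mem hi]

/-- The directions `2πm / lam` in which `exp (z ^ lam)` has maximal modulus. -/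
noncomputable def peak (lam : ℝ) (m : ℤ) : ℝ := 2 * Real.pi * m / lam

/-- **Laplace's method** on a symmetric interval that may contain several peaks. -/
theorem tendsto_laplace_interval {ι : Type*} {l : Filter ι} [l.IsCountablyGenerated] {lam θ : ℝ}
    (hlam : 0 < lam) (hθ : 0 < θ) {N : ι → ℝ} (hN : Tendsto N l atTop) {h : ι → ℝ → ℂ}
    {L : ℤ → ℝ → ℂ} {C : ℝ} {K : ℕ} (hK : θ < (2 * K + 1) * (Real.pi / lam))
    (hh : ∀ᶠ i in l, Continuous (h i)) (hC : ∀ᶠ i in l, ∀ φ, |φ| ≤ θ → ‖h i φ‖ ≤ C)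
    (hL : ∀ (m : ℤ) (s : ℝ), Tendsto (fun i => (Set.Icc (-θ) θ).indicator (h i)
      (peak lam m + s / Real.sqrt (N i))) l (𝓝 (L m s))) :
    Tendsto (fun i => (Real.sqrt (N i) : ℂ) * (∫ φ in (-θ)..θ, h i φ *
        exp ((N i / lam : ℂ) * (exp (lam * φ * I) - 1) - N i * φ * I)) -
      ∑ j ∈ Finset.range (2 * K + 1), exp (-(N i * peak lam (j - K) * I)) *
        ∫ s : ℝ, L (j - K) s * exp (-(lam * s ^ 2 / 2))) l (𝓝 0) := by
  set S : Set ℝ := Set.Icc (-θ) θ with hS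
  -- Endpoints of consecutive windows of half-width `π/λ`, the `j`-th centred at the peak of index
  -- `j - K`; together they cover `[-θ, θ]`.
  set a : ℕ → ℝ := fun j => (2 * j - 2 * K - 1) * (Real.pi / lam) with ha
  set E : ι → ℝ → ℂ := fun i φ =>
    exp ((N i / lam : ℂ) * (exp (lam * φ * I) - 1) - N i * φ * I) with hE
  have hlam' : (lam : ℂ) ≠ 0 := by exact_mod_cast hlam.ne'
  have hEc : ∀ i, Continuous (E i) := fun i => by simp only [hE]; fun_prop
  -- Translation by a peak preserves `e^{iλφ}`, so every window carries the same kernel up to a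
  -- unimodular phase.
  have hEp : ∀ i (m : ℤ) (x : ℝ), E i (x + peak lam m) =
      exp (-(N i * peak lam m * I)) * laplaceKernel lam (N i) x := by
    intro i m x
    simp only [hE, laplaceKernel]
    rw [← exp_add]
    have e : exp (lam * (x + peak lam m : ℝ) * I) = exp (lam * x * I) := by
      have : (lam * (x + peak lam m : ℝ) * I : ℂ) = lam * x * I + m * (2 * Real.pi * I) := by
        unfold peak; push_cast; field_simp
      rw [this, exp_add, exp_int_mul_two_pi_mul_I, mul_one]
    rw [e]
    congr 1
    push_cast
    field_simp
    ring
  have hpeak : ∀ m : ℤ, Tendsto (fun i => (Real.sqrt (N i) : ℂ) *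
      ∫ φ in (-(Real.pi / lam))..(Real.pi / lam), S.indicator (h i) (φ + peak lam m) *
        laplaceKernel lam (N i) φ) l (𝓝 (∫ s : ℝ, L m s * exp (-(lam * s ^ 2 / 2)))) := by
    intro m
    refine tendsto_laplace_peak (C := C) hlam hN ?_ ?_ ?_
    · filter_upwards [hh] with i hi
      exact (hi.measurable.indicator measurableSet_Icc).comp (measurable_id.add_const _)
    · filter_upwards [hC] with i hi φ
      by_cases hφ : φ + peak lam m ∈ S
      · rw [Set.indicator_of_mem hφ]
        exact hi _ (abs_le.2 hφ)
      · rw [Set.indicator_of_notMem hφ, norm_zero]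
        exact (norm_nonneg _).trans (hi 0 (by simpa using hθ.le))
    · intro s
      simp_rw [add_comm _ (peak lam m)]
      exact hL m s
  have hsplit : ∀ᶠ i in l, (∫ φ in (-θ)..θ, h i φ * E i φ) =
      ∑ j ∈ Finset.range (2 * K + 1), exp (-(N i * peak lam (j - K) * I)) *
        ∫ φ in (-(Real.pi / lam))..(Real.pi / lam),
          S.indicator (h i) (φ + peak lam (j - K)) * laplaceKernel lam (N i) φ := by
    filter_upwards [hh] with i hi
    have hsub : S ⊆ Set.Ioc (a 0) (a (2 * K + 1)) := by
      intro x hx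
      have h0 : a 0 = -((2 * K + 1) * (Real.pi / lam)) := by simp only [ha]; push_cast; ring
      have h1 : a (2 * K + 1) = (2 * K + 1) * (Real.pi / lam) := by
        simp only [ha]; push_cast; ring
      rw [h0, h1]
      exact ⟨by linarith [hx.1], by linarith [hx.2]⟩
    have hle : a 0 ≤ a (2 * K + 1) := by
      have : (0 : ℝ) ∈ S := ⟨by linarith, hθ.le⟩
      exact (hsub this).1.le.trans (hsub this).2
    have hci : Integrable (S.indicator fun φ => h i φ * E i φ) := by
      rw [integrable_indicator_iff measurableSet_Icc]
      exact (hi.mul (hEc i)).continuousOn.integrableOn_Icc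
    have h1 : (∫ φ in (-θ)..θ, h i φ * E i φ) =
        ∫ φ in (a 0)..(a (2 * K + 1)), S.indicator (fun φ => h i φ * E i φ) φ := by
      rw [intervalIntegral.integral_of_le (by linarith), intervalIntegral.integral_of_le hle,
        setIntegral_indicator measurableSet_Icc, Set.inter_eq_self_of_subset_right hsub,
        integral_Icc_eq_integral_Ioc]
    rw [h1, ← intervalIntegral.sum_integral_adjacent_intervals
      (fun k _ => hci.intervalIntegrable)]
    refine Finset.sum_congr rfl fun j _ => ?_
    have e1 : a j = -(Real.pi / lam) + peak lam (j - K) := by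
      simp only [ha, peak]; push_cast; field_simp; ring
    have e2 : a (j + 1) = Real.pi / lam + peak lam (j - K) := by
      simp only [ha, peak]; push_cast; field_simp; ring
    rw [e1, e2, ← intervalIntegral.integral_comp_add_right, ← intervalIntegral.integral_const_mul]
    refine intervalIntegral.integral_congr fun φ _ => ?_
    rw [Set.indicator_mul_left, hEp]
    ring
  have hterm : ∀ j : ℕ, Tendsto (fun i => exp (-(N i * peak lam (j - K) * I)) *
      ((Real.sqrt (N i) : ℂ) * (∫ φ in (-(Real.pi / lam))..(Real.pi / lam),
        S.indicator (h i) (φ + peak lam (j - K)) * laplaceKernel lam (N i) φ) -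
        ∫ s : ℝ, L (j - K) s * exp (-(lam * s ^ 2 / 2)))) l (𝓝 0) := by
    intro j
    have := (tendsto_sub_nhds_zero_iff.2 (hpeak (j - K))).norm
    rw [norm_zero] at this
    refine squeeze_zero_norm (fun i => le_of_eq ?_) this
    rw [norm_mul]
    have : (-(N i * peak lam (j - K) * I) : ℂ) = ((-(N i * peak lam (j - K)) : ℝ) : ℂ) * I := by
      push_cast; ring
    rw [this, norm_exp_ofReal_mul_I, one_mul]
  have hsum := tendsto_finsetSum (Finset.range (2 * K + 1)) (fun j _ => hterm j)
  rw [Finset.sum_const_zero] at hsum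
  refine hsum.congr' ?_
  filter_upwards [hsplit] with i hi
  rw [hi, Finset.mul_sum, ← Finset.sum_sub_distrib]
  exact Finset.sum_congr rfl fun j _ => by ring

/-! ### The asymptotics of `f` in logarithmic coordinates -/

theorem ofReal_mul_exp_cpow {r : ℝ} (hr : 0 < r) {v : ℂ} (hv : |v.im| < Real.pi) (a : ℂ) :
    ((r : ℂ) * exp v) ^ a = (r : ℂ) ^ a * exp (a * v) := by
  have hr' : (r : ℂ) ≠ 0 := by exact_mod_cast hr.ne'
  obtain ⟨h1, h2⟩ := abs_lt.1 hv
  rw [cpow_def_of_ne_zero (mul_ne_zero hr' (exp_ne_zero _)), log_ofReal_mul hr (exp_ne_zero _),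
    log_exp h1 h2.le, cpow_def_of_ne_zero hr', ← exp_add, ofReal_log hr.le]
  congr 1; ring

theorem arg_ofReal_mul_exp {r : ℝ} (hr : 0 < r) {v : ℂ} (h1 : -Real.pi < v.im)
    (h2 : v.im ≤ Real.pi) : arg ((r : ℂ) * exp v) = v.im := by
  rw [arg_real_mul _ hr, exp_eq_exp_re_mul_sin_add_cos, ← ofReal_exp,
    arg_real_mul _ (Real.exp_pos _), ← ofReal_cos, ← ofReal_sin]
  rw [ofReal_cos, ofReal_sin, arg_cos_add_sin_mul_I ⟨h1, h2⟩]

theorem mul_exp_mem_sector {ζ : ℂ} (hζ : ‖ζ‖ = 1) {r θ : ℝ} (hr : 0 < r) (hθ : θ < Real.pi) {v : ℂ}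
    (hv : |v.im| ≤ θ) : (r : ℂ) * ζ * exp v ∈ sector θ ζ := by
  have hr' : (r : ℂ) ≠ 0 := by exact_mod_cast hr.ne'
  have hζ0 : ζ ≠ 0 := by intro h; simp [h] at hζ
  obtain ⟨h1, h2⟩ := abs_le.1 hv
  refine ⟨mul_ne_zero (mul_ne_zero hr' hζ0) (exp_ne_zero _), ?_⟩
  have : (r : ℂ) * ζ * exp v / ζ = (r : ℂ) * exp v := by field_simp
  rw [this, arg_ofReal_mul_exp hr (by linarith) (by linarith)]
  exact hv

/-- The quotient of `f (r ζ exp v)` by `r ^ b * exp ((r * exp v) ^ lam)`. -/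
noncomputable def normalized (f : ℂ → ℂ) (b ζ : ℂ) (lam r : ℝ) (v : ℂ) : ℂ :=
  f (r * ζ * exp v) * ((r : ℂ) ^ b)⁻¹ * exp (-(((r ^ lam : ℝ) : ℂ) * exp (lam * v)))

theorem normalized_eq_of_eq {f : ℂ → ℂ} {A b ζ : ℂ} (hζ : ‖ζ‖ = 1) {lam r : ℝ} (hr : 0 < r)
    {v c : ℂ} (hv : |v.im| < Real.pi)
    (h : f (r * ζ * exp v) = c * (A * (r * ζ * exp v / ζ) ^ b *
      exp ((r * ζ * exp v / ζ) ^ (lam : ℂ)))) :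
    normalized f b ζ lam r v = c * (A * exp (b * v)) := by
  have hζ0 : ζ ≠ 0 := by intro h; simp [h] at hζ
  have hr' : (r : ℂ) ^ b ≠ 0 := by
    rw [cpow_ne_zero_iff]; left; exact_mod_cast hr.ne'
  have e : (r : ℂ) * ζ * exp v / ζ = (r : ℂ) * exp v := by field_simp
  rw [e, ofReal_mul_exp_cpow hr hv, ofReal_mul_exp_cpow hr hv, ← ofReal_cpow hr.le] at h
  rw [normalized, h, exp_neg]
  have := exp_ne_zero (((r ^ lam : ℝ) : ℂ) * exp (lam * v))
  field_simp

/-- Complex `v` is allowed, not only imaginary `v`, because the corner point does not lie on the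
circle of integration. -/
theorem tendsto_normalized {f : ℂ → ℂ} {A b ζ : ℂ} (hζ : ‖ζ‖ = 1) {lam θ : ℝ} (hθ : θ < Real.pi)
    (hf : f ~[atInftyWithin (sector θ ζ)]
      fun z => A * (z / ζ) ^ b * exp ((z / ζ) ^ (lam : ℂ)))
    {ι : Type*} {l : Filter ι} {r : ι → ℝ} (hr : Tendsto r l atTop) {v : ι → ℂ} {v₀ : ℂ}
    (hv : Tendsto v l (𝓝 v₀)) (hvθ : ∀ᶠ i in l, |(v i).im| ≤ θ) :
    Tendsto (fun i => normalized f b ζ lam (r i) (v i)) l (𝓝 (A * exp (b * v₀))) := by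
  obtain ⟨ψ, hψ, hfψ⟩ := hf.exists_eq_mul
  have hpos : ∀ᶠ i in l, 0 < r i := hr.eventually_gt_atTop 0
  have hz : Tendsto (fun i => (r i : ℂ) * ζ * exp (v i)) l (atInftyWithin (sector θ ζ)) := by
    refine tendsto_inf.2 ⟨?_, tendsto_principal.2 ?_⟩
    · rw [← tendsto_norm_atTop_iff_cobounded]
      have h1 : Tendsto (fun i => ‖exp (v i)‖) l (𝓝 ‖exp v₀‖) :=
        ((continuous_exp.tendsto _).comp hv).norm
      refine (hr.atTop_mul_pos (by simp) h1).congr' ?_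
      filter_upwards [hpos] with i hi
      simp [hζ, abs_of_pos hi]
    · filter_upwards [hpos, hvθ] with i hi hvi
      exact mul_exp_mem_sector hζ hi hθ hvi
  have h1 : Tendsto (fun i => ψ ((r i : ℂ) * ζ * exp (v i)) * (A * exp (b * v i))) l
      (𝓝 (1 * (A * exp (b * v₀)))) :=
    (hψ.comp hz).mul (((continuous_exp.tendsto _).comp (hv.const_mul b)).const_mul A)
  rw [one_mul] at h1
  refine h1.congr' ?_
  filter_upwards [hpos, hvθ, hz.eventually hfψ] with i hi hvi hfi
  exact (normalized_eq_of_eq hζ hi (hvi.trans_lt hθ) hfi).symm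

theorem eventually_atInftyWithin_iff {S : Set ℂ} {p : ℂ → Prop} :
    (∀ᶠ z in atInftyWithin S, p z) ↔ ∃ R : ℝ, ∀ z ∈ S, R < ‖z‖ → p z := by
  rw [atInftyWithin, eventually_inf_principal,
    (Metric.hasBasis_cobounded_compl_closedBall (0 : ℂ)).eventually_iff]
  simp only [true_and, Set.mem_compl_iff, Metric.mem_closedBall, dist_zero_right, not_le]
  exact ⟨fun ⟨R, h⟩ => ⟨R, fun z hz hR => h hR hz⟩, fun ⟨R, h⟩ => ⟨R, fun z hR hz => h z hz hR⟩⟩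

theorem exists_norm_normalized_le {f : ℂ → ℂ} {A b ζ : ℂ} (hζ : ‖ζ‖ = 1) {lam θ : ℝ}
    (hθ : θ < Real.pi)
    (hf : f ~[atInftyWithin (sector θ ζ)]
      fun z => A * (z / ζ) ^ b * exp ((z / ζ) ^ (lam : ℂ)))
    {ι : Type*} {l : Filter ι} {r : ι → ℝ} (hr : Tendsto r l atTop) :
    ∃ C : ℝ, ∀ᶠ i in l, ∀ φ : ℝ, |φ| ≤ θ → ‖normalized f b ζ lam (r i) (φ * I)‖ ≤ C := by
  obtain ⟨ψ, hψ, hfψ⟩ := hf.exists_eq_mul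
  have hb : ∀ᶠ z in atInftyWithin (sector θ ζ), ‖ψ z‖ ≤ 2 :=
    hψ.norm.eventually_le_const (by simp)
  obtain ⟨R, hR⟩ := eventually_atInftyWithin_iff.1 (hfψ.and hb)
  refine ⟨2 * (‖A‖ * Real.exp (|b.im| * θ)), ?_⟩
  filter_upwards [hr.eventually_gt_atTop 0, hr.eventually_gt_atTop R] with i hi hiR φ hφ
  have him : ((φ : ℂ) * I).im = φ := by simp
  have hmem : (r i : ℂ) * ζ * exp (φ * I) ∈ sector θ ζ :=
    mul_exp_mem_sector hζ hi hθ (by rwa [him])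
  have hn : ‖(r i : ℂ) * ζ * exp (φ * I)‖ = r i := by
    rw [norm_mul, norm_mul, hζ, norm_exp_ofReal_mul_I, norm_real, Real.norm_of_nonneg hi.le]
    ring
  obtain ⟨h1, h2⟩ := hR _ hmem (by rwa [hn])
  rw [normalized_eq_of_eq hζ hi (by rw [him]; exact hφ.trans_lt hθ) h1, norm_mul, norm_mul,
    norm_exp]
  gcongr
  have : (b * (φ * I)).re = -(b.im * φ) := by simp
  rw [this]
  calc -(b.im * φ) ≤ |b.im * φ| := neg_le_abs _
    _ = |b.im| * |φ| := abs_mul _ _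
    _ ≤ _ := by gcongr

/-! ### The scaling radius and the corner points -/

theorem radius_rpow {lam : ℝ} (hlam : 0 < lam) (n : ℕ) : radius lam n ^ lam = n / lam := by
  rw [radius, ← Real.rpow_mul (by positivity), one_div_mul_cancel hlam.ne', Real.rpow_one]

theorem radius_pos {lam : ℝ} (hlam : 0 < lam) {n : ℕ} (hn : 0 < n) : 0 < radius lam n := by
  have : (0 : ℝ) < n := by exact_mod_cast hn
  unfold radius; positivity

theorem tendsto_radius {lam : ℝ} (hlam : 0 < lam) {ι : Type*} {l : Filter ι} {n : ι → ℕ}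
    (hn : Tendsto n l atTop) : Tendsto (fun i => radius lam (n i)) l atTop := by
  unfold radius
  refine (tendsto_rpow_atTop (by positivity)).comp (Tendsto.atTop_div_const hlam ?_)
  exact tendsto_natCast_atTop_atTop.comp hn

theorem tendsto_sqrt_mul_log {ι : Type*} {l : Filter ι} {N : ι → ℝ} (hN : Tendsto N l atTop)
    {w : ι → ℂ} {w₀ : ℂ} (hw : Tendsto w l (𝓝 w₀)) :
    Tendsto (fun i => (Real.sqrt (N i) : ℂ) * log (1 + w i / (Real.sqrt (N i) : ℂ))) l (𝓝 w₀) := by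
  have hu := tendsto_div_sqrt hN hw
  have hpos : ∀ᶠ i in l, 0 < N i := hN.eventually_gt_atTop 0
  have hle : ∀ᶠ i in l, ‖w i / (Real.sqrt (N i) : ℂ)‖ ≤ 1 / 2 := by
    have := hu.norm
    rw [norm_zero] at this
    exact this.eventually_le_const (by norm_num)
  have h1 : Tendsto (fun i => (Real.sqrt (N i) : ℂ) * log (1 + w i / (Real.sqrt (N i) : ℂ)) - w i)
      l (𝓝 0) := by
    have hb : Tendsto (fun i => ‖w i‖ * ‖w i / (Real.sqrt (N i) : ℂ)‖) l (𝓝 0) := by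
      simpa using hw.norm.mul hu.norm
    refine squeeze_zero_norm' ?_ hb
    filter_upwards [hpos, hle] with i hi hi2
    have hs : (Real.sqrt (N i) : ℂ) ≠ 0 := by exact_mod_cast (Real.sqrt_pos.2 hi).ne'
    set u := w i / (Real.sqrt (N i) : ℂ) with hu_def
    have hwu : w i = (Real.sqrt (N i) : ℂ) * u := by rw [hu_def]; field_simp
    rw [hwu, ← mul_sub, norm_mul, norm_mul, mul_assoc]
    gcongr
    refine (norm_log_one_add_sub_self_le (hi2.trans_lt (by norm_num))).trans ?_
    have h3 : (1 - ‖u‖)⁻¹ ≤ 2 := by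
      rw [inv_le_comm₀ (by linarith) (by norm_num)]; linarith
    calc ‖u‖ ^ 2 * (1 - ‖u‖)⁻¹ / 2 ≤ ‖u‖ ^ 2 * 2 / 2 := by gcongr
      _ = ‖u‖ * ‖u‖ := by ring
  simpa using h1.add hw

/-- The behaviour of `f` at the corner points, relative to `z ^ n`. -/
theorem tendsto_cornerPoint_pow_div {f : ℂ → ℂ} {a : ℂ} {lam θ : ℝ} (hlam : 0 < lam) (hθ0 : 0 < θ)
    (hθ : θ < Real.pi)
    (hf : f ~[atInftyWithin (sector θ 1)] fun z => z ^ a * exp (z ^ (lam : ℂ)))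
    {ι : Type*} {l : Filter ι} {n : ι → ℕ} (hn : Tendsto n l atTop) {w : ι → ℂ} {w₀ : ℂ}
    (hw : Tendsto w l (𝓝 w₀)) :
    (∀ᶠ i in l, f (cornerPoint lam (n i) (w i)) ≠ 0) ∧
    Tendsto (fun i => cornerPoint lam (n i) (w i) ^ n i * ((radius lam (n i) : ℂ) ^ n i)⁻¹ *
      (radius lam (n i) : ℂ) ^ a * exp (n i / lam) / f (cornerPoint lam (n i) (w i))) l
      (𝓝 (exp (-(lam * w₀ ^ 2 / 2)))) := by
  have hlam' : (lam : ℂ) ≠ 0 := by exact_mod_cast hlam.ne'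
  have hN : Tendsto (fun i => (n i : ℝ)) l atTop := tendsto_natCast_atTop_atTop.comp hn
  have hpos : ∀ᶠ i in l, 0 < n i := hn.eventually_gt_atTop 0
  have hf' : f ~[atInftyWithin (sector θ 1)]
      fun z => 1 * (z / 1) ^ a * exp ((z / 1) ^ (lam : ℂ)) := by simpa using hf
  -- With `z = r_n e^v` and `√n v → w₀`, the quotient has exponent `-(n/λ)(e^{λv} - 1 - λv)`, whose
  -- limit is `-λw₀²/2`.
  set v : ι → ℂ := fun i => log (1 + w i / (Real.sqrt (n i) : ℂ)) with hv_def
  have hsv : Tendsto (fun i => (Real.sqrt (n i) : ℂ) * v i) l (𝓝 w₀) := tendsto_sqrt_mul_log hN hw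
  have hu := tendsto_div_sqrt hN hw
  have hv : Tendsto v l (𝓝 0) := by
    refine (tendsto_div_sqrt hN hsv).congr' ?_
    filter_upwards [hpos] with i hi
    have : (Real.sqrt (n i) : ℂ) ≠ 0 := by
      exact_mod_cast (Real.sqrt_pos.2 (Nat.cast_pos.2 hi)).ne'
    field_simp
  have hvθ : ∀ᶠ i in l, |(v i).im| ≤ θ := by
    have h1 : Tendsto (fun i => |(v i).im|) l (𝓝 0) := by
      have := ((continuous_im.tendsto _).comp hv).abs
      simpa using this
    exact h1.eventually_le_const hθ0
  have hq := tendsto_normalized (by simp) hθ hf' (tendsto_radius hlam hn) hv hvθ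
  rw [mul_zero, exp_zero, mul_one] at hq
  have hq0 : ∀ᶠ i in l, normalized f a 1 lam (radius lam (n i)) (v i) ≠ 0 :=
    hq.eventually_ne one_ne_zero
  have hcp : ∀ᶠ i in l, cornerPoint lam (n i) (w i) = radius lam (n i) * exp (v i) := by
    have h1 : ∀ᶠ i in l, 1 + w i / (Real.sqrt (n i) : ℂ) ≠ 0 := by
      have := hu.const_add 1
      rw [add_zero] at this
      exact this.eventually_ne one_ne_zero
    filter_upwards [h1] with i hi
    rw [cornerPoint, hv_def, exp_log hi]
  have hfq : ∀ᶠ i in l, f (cornerPoint lam (n i) (w i)) =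
      normalized f a 1 lam (radius lam (n i)) (v i) * (radius lam (n i) : ℂ) ^ a *
        exp ((n i / lam : ℂ) * exp (lam * v i)) := by
    filter_upwards [hcp, hpos] with i hi hi0
    have hr := radius_pos hlam hi0
    have hr' : (radius lam (n i) : ℂ) ^ a ≠ 0 := by
      rw [cpow_ne_zero_iff]; left; exact_mod_cast hr.ne'
    rw [normalized, mul_one, ← hi, radius_rpow hlam, exp_neg]
    push_cast
    have := exp_ne_zero ((n i / lam : ℂ) * exp (lam * v i))
    field_simp
  refine ⟨?_, ?_⟩
  · filter_upwards [hfq, hq0, hpos] with i hi h0 hi0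
    have hr := radius_pos hlam hi0
    have hr' : (radius lam (n i) : ℂ) ^ a ≠ 0 := by
      rw [cpow_ne_zero_iff]; left; exact_mod_cast hr.ne'
    rw [hi]
    exact mul_ne_zero (mul_ne_zero h0 hr') (exp_ne_zero _)
  · have h1 : Tendsto (fun i => (Real.sqrt (n i) : ℂ) * (lam * v i)) l (𝓝 (lam * w₀)) :=
      (hsv.const_mul (lam : ℂ)).congr fun i => by ring
    have h2 := ((tendsto_mul_exp_sub_one_sub hN h1).mul_const (lam : ℂ)⁻¹).neg
    have h3 := ((continuous_exp.tendsto _).comp h2).div hq one_ne_zero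
    have e : exp (-((lam * w₀ : ℂ) ^ 2 / 2 * (lam : ℂ)⁻¹)) / 1 = exp (-(lam * w₀ ^ 2 / 2)) := by
      rw [div_one]; congr 1; field_simp
    rw [e] at h3
    refine h3.congr' ?_
    filter_upwards [hfq, hq0, hpos, hcp] with i hi h0 hi0 hci
    have hr := radius_pos hlam hi0
    have hr0 : (radius lam (n i) : ℂ) ≠ 0 := by exact_mod_cast hr.ne'
    have hr' : (radius lam (n i) : ℂ) ^ a ≠ 0 := by
      rw [cpow_ne_zero_iff]; exact Or.inl hr0
    rw [hi, hci, mul_pow, ← exp_nat_mul]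
    have h4 : exp (-((n i : ℂ) * (exp (lam * v i) - 1 - lam * v i) * (lam : ℂ)⁻¹)) =
        exp (n i * v i) * exp (n i / lam) / exp ((n i / lam : ℂ) * exp (lam * v i)) := by
      rw [← exp_add, ← exp_sub]; congr 1; field_simp; ring
    simp only [Pi.div_apply, Function.comp_apply, ofReal_natCast]
    rw [h4]
    have h5 := exp_ne_zero ((n i / lam : ℂ) * exp (lam * v i))
    field_simp

/-- Let `δ = -Re w₀ / 4`. Eventually `Re w ≤ -2δ`, so in the squared modulus the linear term is at
most `-4δ/√N`, and the quadratic one is at most `2δ/√N`. The total is below `(1 - δ/√N)²`. -/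
theorem eventually_norm_one_add_div_sqrt_le {ι : Type*} {l : Filter ι} {N : ι → ℝ}
    (hN : Tendsto N l atTop) {w : ι → ℂ} {w₀ : ℂ} (hw : Tendsto w l (𝓝 w₀)) (hw₀ : w₀.re < 0) :
    ∀ᶠ i in l, ‖1 + w i / (Real.sqrt (N i) : ℂ)‖ ≤ 1 - -w₀.re / 4 / Real.sqrt (N i) := by
  set δ := -w₀.re / 4 with hδ
  have hδ0 : 0 < δ := by rw [hδ]; linarith
  have hs : Tendsto (fun i => Real.sqrt (N i)) l atTop := Real.tendsto_sqrt_atTop.comp hN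
  have h1 : ∀ᶠ i in l, (w i).re ≤ -2 * δ :=
    ((continuous_re.tendsto _).comp hw).eventually_le_const (by rw [hδ]; linarith)
  have h2 : ∀ᶠ i in l, ‖w i‖ ≤ ‖w₀‖ + 1 := hw.norm.eventually_le_const (by linarith)
  filter_upwards [h1, h2, hs.eventually_gt_atTop 0, hs.eventually_ge_atTop δ,
    hs.eventually_ge_atTop ((‖w₀‖ + 1) ^ 2 / (2 * δ))] with i h1 h2 h3 h4 h5
  set s := Real.sqrt (N i) with hsdef
  have h6 : 0 ≤ 1 - δ / s := by
    rw [sub_nonneg, div_le_one h3]; exact h4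
  refine le_of_sq_le_sq ?_ h6
  have e : ‖1 + w i / (s : ℂ)‖ ^ 2 = 1 + 2 * (w i).re / s + ‖w i‖ ^ 2 / s ^ 2 := by
    rw [← normSq_eq_norm_sq, normSq_add, map_one, map_div₀, normSq_ofReal, one_mul,
      normSq_eq_norm_sq, conj_re, div_ofReal_re]
    ring
  rw [e]
  have h7 : ‖w i‖ ^ 2 ≤ 2 * δ * s := by
    rw [div_le_iff₀ (by positivity)] at h5
    calc ‖w i‖ ^ 2 ≤ (‖w₀‖ + 1) ^ 2 := by gcongr
      _ ≤ _ := by linarith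
  have h8 : ‖w i‖ ^ 2 / s ^ 2 ≤ 2 * δ / s := by
    rw [div_le_div_iff₀ (by positivity) h3]
    calc ‖w i‖ ^ 2 * s ≤ 2 * δ * s * s := by gcongr
      _ = _ := by ring
  have h9 : 2 * (w i).re / s ≤ 2 * (-2 * δ) / s := by gcongr
  have h10 : 2 * (-2 * δ) / s = -4 * (δ / s) := by ring
  have h11 : 2 * δ / s = 2 * (δ / s) := by ring
  nlinarith [sq_nonneg (δ / s)]

/-! ### Geometry of the two sectors -/

theorem exists_angle_of_disjoint {ζ : ℂ} (hζ : ‖ζ‖ = 1) {θ : ℝ} (hθ : θ < Real.pi)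
    (hdisj : Disjoint (sector θ 1) (sector θ ζ)) :
    ∃ α : ℝ, ζ = exp (α * I) ∧ 2 * θ < α ∧ α < 2 * Real.pi - 2 * θ := by
  -- If `|β| ≤ 2θ`, the bisecting direction `β/2` lies in both sectors. Applied to `α` and `α - 2π`,
  -- this gives the two bounds.
  have key : ∀ β : ℝ, exp (β * I) = ζ → 2 * θ < |β| := by
    intro β hβ
    by_contra! h
    have h2 : |β / 2| ≤ θ := by rw [abs_div, abs_two]; linarith
    have m1 := mul_exp_mem_sector (ζ := 1) (r := 1) (v := (β / 2 : ℝ) * I) (by simp) one_pos hθ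
      (by simpa using h2)
    have m2 := mul_exp_mem_sector (r := 1) (v := (-(β / 2) : ℝ) * I) hζ one_pos hθ
      (by simpa using h2)
    have e : ((1 : ℝ) : ℂ) * ζ * exp ((-(β / 2) : ℝ) * I) =
        ((1 : ℝ) : ℂ) * 1 * exp ((β / 2 : ℝ) * I) := by
      rw [← hβ, ofReal_one, one_mul, one_mul, one_mul, ← exp_add]
      congr 1; push_cast; ring
    rw [e] at m2
    exact Set.disjoint_left.1 hdisj m1 m2
  have harg : exp (arg ζ * I) = ζ := by
    have := norm_mul_exp_arg_mul_I ζ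
    rwa [hζ, ofReal_one, one_mul] at this
  have hper : ∀ x : ℝ, exp ((x + 2 * Real.pi : ℝ) * I) = exp (x * I) := by
    intro x
    push_cast
    rw [add_mul, exp_add, exp_two_pi_mul_I, mul_one]
  have hper' : ∀ x : ℝ, exp ((x - 2 * Real.pi : ℝ) * I) = exp (x * I) := by
    intro x
    rw [← hper (x - 2 * Real.pi), sub_add_cancel]
  have hfin : ∀ α : ℝ, 0 ≤ α → α < 2 * Real.pi → exp (α * I) = ζ →
      2 * θ < α ∧ α < 2 * Real.pi - 2 * θ := by
    intro α h0 h1 h2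
    have k1 := key α h2
    have k2 := key (α - 2 * Real.pi) ((hper' α).trans h2)
    rw [abs_of_nonneg h0] at k1
    rw [abs_of_neg (by linarith)] at k2
    exact ⟨k1, by linarith⟩
  have hp := Real.pi_pos
  rcases le_or_gt 0 (arg ζ) with h | h
  · exact ⟨arg ζ, harg.symm, hfin _ h (by linarith [arg_le_pi ζ]) harg⟩
  · exact ⟨arg ζ + 2 * Real.pi, ((hper _).trans harg).symm,
      hfin _ (by linarith [neg_pi_lt_arg ζ]) (by linarith) ((hper _).trans harg)⟩

theorem mul_exp_notMem_sector {ζ : ℂ} (hζ : ‖ζ‖ = 1) {r θ φ : ℝ} (hr : 0 < r)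
    (h1 : θ < φ) (h2 : φ < 2 * Real.pi - θ) (hθ : 0 < θ) :
    (r : ℂ) * ζ * exp (φ * I) ∉ sector θ ζ := by
  have hζ0 : ζ ≠ 0 := by intro h; simp [h] at hζ
  rintro ⟨-, h⟩
  have e : (r : ℂ) * ζ * exp (φ * I) / ζ = (r : ℂ) * exp (φ * I) := by field_simp
  rw [e] at h
  have hp := Real.pi_pos
  rcases le_or_gt φ Real.pi with hφ | hφ
  · rw [arg_ofReal_mul_exp hr (by simp; linarith) (by simpa using hφ)] at h
    simp only [mul_im, ofReal_re, I_im, mul_one, ofReal_im, I_re, mul_zero,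
      add_zero] at h
    rw [abs_of_pos (by linarith)] at h
    linarith
  · have e2 : exp (φ * I) = exp ((φ - 2 * Real.pi : ℝ) * I) := by
      have : (φ * I : ℂ) = (φ - 2 * Real.pi : ℝ) * I + 2 * Real.pi * I := by push_cast; ring
      rw [this, exp_add, exp_two_pi_mul_I, mul_one]
    rw [e2, arg_ofReal_mul_exp hr (by simp; linarith) (by simp; linarith)] at h
    simp only [mul_im, ofReal_re, I_im, mul_one, ofReal_im, I_re, mul_zero,
      add_zero] at h
    rw [abs_of_neg (by linarith)] at h
    linarith

theorem one_sub_cos_le_norm_exp_sub_one {θ ψ : ℝ} (hθ : 0 < θ) (h1 : θ ≤ ψ)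
    (h2 : ψ ≤ 2 * Real.pi - θ) : 1 - Real.cos θ ≤ ‖exp (ψ * I) - 1‖ := by
  have hc : Real.cos ψ ≤ Real.cos θ := by
    rcases le_or_gt ψ Real.pi with h | h
    · exact Real.cos_le_cos_of_nonneg_of_le_pi hθ.le h h1
    · rw [← Real.cos_two_pi_sub ψ]
      exact Real.cos_le_cos_of_nonneg_of_le_pi hθ.le (by linarith) (by linarith)
  calc 1 - Real.cos θ ≤ 1 - Real.cos ψ := by linarith
    _ = -(exp (ψ * I) - 1).re := by rw [sub_re, exp_ofReal_mul_I_re, one_re]; ring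
    _ ≤ |(exp (ψ * I) - 1).re| := neg_le_abs _
    _ ≤ _ := abs_re_le_norm _

/-- A peak may lie exactly on an edge `±θ`. The sign of `s` then decides on which side the rescaled
point stays, so the indicator still has a pointwise limit. -/
theorem eventually_mem_or_eventually_notMem_Icc {ι : Type*} {l : Filter ι} {N : ι → ℝ}
    (hN : Tendsto N l atTop) {θ : ℝ} (p s : ℝ) :
    (∀ᶠ i in l, p + s / Real.sqrt (N i) ∈ Set.Icc (-θ) θ) ∨
    (∀ᶠ i in l, p + s / Real.sqrt (N i) ∉ Set.Icc (-θ) θ) := by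
  have hs : Tendsto (fun i => Real.sqrt (N i)) l atTop := Real.tendsto_sqrt_atTop.comp hN
  have key : ∀ p s : ℝ, (∀ᶠ i in l, p + s / Real.sqrt (N i) ≤ θ) ∨
      (∀ᶠ i in l, θ < p + s / Real.sqrt (N i)) := by
    intro p s
    have ht : Tendsto (fun i => p + s / Real.sqrt (N i)) l (𝓝 p) := by
      simpa using (hs.const_div_atTop s).const_add p
    rcases lt_trichotomy p θ with h | h | h
    · exact Or.inl (ht.eventually_le_const h)
    · rcases le_or_gt s 0 with h0 | h0
      · refine Or.inl ?_
        filter_upwards [hs.eventually_gt_atTop 0] with i hi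
        have := div_nonpos_of_nonpos_of_nonneg h0 hi.le
        linarith
      · refine Or.inr ?_
        filter_upwards [hs.eventually_gt_atTop 0] with i hi
        have := div_pos h0 hi
        linarith
    · exact Or.inr (ht.eventually_const_lt h)
  rcases key p s with h1 | h1
  · rcases key (-p) (-s) with h2 | h2
    · left
      filter_upwards [h1, h2] with i h1 h2
      rw [neg_div] at h2
      exact ⟨by linarith, h1⟩
    · right
      filter_upwards [h2] with i h2 h
      rw [neg_div] at h2
      linarith [h.1]
  · right
    filter_upwards [h1] with i h1 h
    linarith [h.2]

/-! ### Contributions of the sectors and of the remaining arcs -/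

/-- The integrand of the remainder formula on the circle of radius `r`. -/
noncomputable def remainderIntegrand (f : ℂ → ℂ) (n : ℕ) (r : ℝ) (z : ℂ) (φ : ℝ) : ℂ :=
  f (r * exp (φ * I)) * ((r * exp (φ * I)) ^ n)⁻¹ * (r * exp (φ * I) / (r * exp (φ * I) - z))

theorem continuous_remainderIntegrand {f : ℂ → ℂ} (hf : Continuous f) (n : ℕ) {r : ℝ} {z : ℂ}
    (hz : ‖z‖ < r) : Continuous (remainderIntegrand f n r z) := by
  have hr : 0 < r := (norm_nonneg z).trans_lt hz
  unfold remainderIntegrand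
  refine Continuous.mul (Continuous.mul (by fun_prop) (Continuous.inv₀ (by fun_prop) ?_))
    (Continuous.div (by fun_prop) (by fun_prop) ?_)
  · intro φ
    exact pow_ne_zero _ (mul_ne_zero (by exact_mod_cast hr.ne') (exp_ne_zero _))
  · intro φ h
    rw [sub_eq_zero] at h
    rw [← h, norm_mul, norm_exp_ofReal_mul_I, mul_one, norm_real, Real.norm_of_nonneg hr.le] at hz
    exact lt_irrefl _ hz

/-- The slowly varying factor of the remainder integrand in the sector about `ζ`. -/
noncomputable def amplitude (f : ℂ → ℂ) (b ζ : ℂ) (lam : ℝ) (n : ℕ) (w : ℂ) (φ : ℝ) : ℂ :=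
  normalized f b ζ lam (radius lam n) (φ * I) *
    (ζ * exp (φ * I) / (ζ * exp (φ * I) - (1 + w / (Real.sqrt n : ℂ))))

theorem continuous_amplitude {f : ℂ → ℂ} (hf : Continuous f) (b : ℂ) {ζ : ℂ} (hζ : ‖ζ‖ = 1)
    (lam : ℝ) (n : ℕ) {w : ℂ} (hw : ‖1 + w / (Real.sqrt n : ℂ)‖ < 1) :
    Continuous (amplitude f b ζ lam n w) := by
  unfold amplitude normalized
  refine Continuous.mul (by fun_prop) (Continuous.div (by fun_prop) (by fun_prop) ?_)
  intro φ h
  rw [sub_eq_zero] at h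
  rw [← h, norm_mul, hζ, norm_exp_ofReal_mul_I] at hw
  norm_num at hw

/-- The prefactor normalises by the peak height in direction `1`, so for the other sector the ratio
`r^b / r^a` and the phase `ζ^{-n}` remain. -/
theorem remainderIntegrand_eq_amplitude (f : ℂ → ℂ) (a b : ℂ) {ζ : ℂ} {α : ℝ}
    (hζ : ζ = exp (α * I)) {lam : ℝ} (hlam : 0 < lam) {n : ℕ} (hn : 0 < n) (w : ℂ) (φ : ℝ) :
    (radius lam n : ℂ) ^ n * ((radius lam n : ℂ) ^ a)⁻¹ * exp (-(n / lam)) *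
      remainderIntegrand f n (radius lam n) (cornerPoint lam n w) (φ + α) =
    (radius lam n : ℂ) ^ b / (radius lam n : ℂ) ^ a * (ζ ^ n)⁻¹ * (amplitude f b ζ lam n w φ *
      exp (((n : ℝ) / lam : ℂ) * (exp (lam * φ * I) - 1) - (n : ℝ) * φ * I)) := by
  have hr := radius_pos hlam hn
  have hr0 : (radius lam n : ℂ) ≠ 0 := by exact_mod_cast hr.ne'
  have hra : ∀ c : ℂ, (radius lam n : ℂ) ^ c ≠ 0 := fun c => by
    rw [cpow_ne_zero_iff]; exact Or.inl hr0
  have hζ0 : ζ ≠ 0 := by rw [hζ]; exact exp_ne_zero _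
  have e1 : (radius lam n : ℂ) * exp ((φ + α : ℝ) * I) = radius lam n * (ζ * exp (φ * I)) := by
    rw [hζ, ← exp_add]; congr 2; push_cast; ring
  have e2 : exp (((n : ℝ) / lam : ℂ) * (exp (lam * φ * I) - 1) - (n : ℝ) * φ * I) =
      exp ((n / lam : ℂ) * exp (lam * (φ * I))) * exp (-(n / lam)) * (exp (φ * I) ^ n)⁻¹ := by
    rw [← exp_nat_mul, ← exp_neg, ← exp_add, ← exp_add]
    congr 1
    rw [← mul_assoc (lam : ℂ)]; push_cast; ring
  have hE := exp_ne_zero ((n / lam : ℂ) * exp (lam * (φ * I)))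
  have hE2 := exp_ne_zero (φ * I)
  rw [remainderIntegrand, amplitude, normalized, e1, e2, cornerPoint, radius_rpow hlam, ← mul_sub,
    mul_div_mul_left _ _ hr0, exp_neg (_ * exp _), mul_assoc (radius lam n : ℂ) ζ]
  push_cast
  set D := ζ * exp (φ * I) / (ζ * exp (φ * I) - (1 + w / (Real.sqrt n : ℂ)))
  have := hra a
  have := hra b
  field_simp
  ring

theorem tendsto_exp_add_div_sqrt {ι : Type*} {l : Filter ι} {N : ι → ℝ} (hN : Tendsto N l atTop)
    (p s : ℝ) : Tendsto (fun i => (p + s / Real.sqrt (N i) : ℝ) * I) l (𝓝 (p * I)) := by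
  have h : Tendsto (fun i => p + s / Real.sqrt (N i)) l (𝓝 p) := by
    simpa using ((Real.tendsto_sqrt_atTop.comp hN).const_div_atTop s).const_add p
  exact ((continuous_ofReal.tendsto _).comp h).mul_const I

/-- At a fixed direction other than `1`, the amplitude converges. -/
theorem tendsto_amplitude {f : ℂ → ℂ} {A b ζ : ℂ} (hζ : ‖ζ‖ = 1) {lam θ : ℝ} (hlam : 0 < lam)
    (hθ : θ < Real.pi)
    (hf : f ~[atInftyWithin (sector θ ζ)]
      fun z => A * (z / ζ) ^ b * exp ((z / ζ) ^ (lam : ℂ)))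
    {ι : Type*} {l : Filter ι} {n : ι → ℕ} (hn : Tendsto n l atTop) {w : ι → ℂ} {w₀ : ℂ}
    (hw : Tendsto w l (𝓝 w₀)) {p s : ℝ} (hp : ζ * exp (p * I) ≠ 1)
    (hmem : ∀ᶠ i in l, p + s / Real.sqrt (n i) ∈ Set.Icc (-θ) θ) :
    Tendsto (fun i => amplitude f b ζ lam (n i) (w i) (p + s / Real.sqrt (n i))) l
      (𝓝 (A * exp (b * (p * I)) * (ζ * exp (p * I) / (ζ * exp (p * I) - 1)))) := by
  have hN : Tendsto (fun i => (n i : ℝ)) l atTop := tendsto_natCast_atTop_atTop.comp hn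
  have hv := tendsto_exp_add_div_sqrt hN p s
  have hq := tendsto_normalized hζ hθ hf (tendsto_radius hlam hn) hv (by
    filter_upwards [hmem] with i hi
    simpa using abs_le.2 hi)
  have hX := ((continuous_exp.tendsto _).comp hv).const_mul ζ
  have hu := (tendsto_div_sqrt hN hw).const_add 1
  rw [add_zero] at hu
  exact hq.mul (hX.div (hX.sub hu) (sub_ne_zero.2 hp))

/-- The contribution of the sector about `1`. -/
theorem tendsto_first_sector {f : ℂ → ℂ} (hfc : Continuous f) {a : ℂ} {lam θ : ℝ} (hlam : 0 < lam)
    (hθ0 : 0 < θ) (hθ : θ < Real.pi)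
    (hf : f ~[atInftyWithin (sector θ 1)] fun z => z ^ a * exp (z ^ (lam : ℂ)))
    {ι : Type*} {l : Filter ι} [l.IsCountablyGenerated] {n : ι → ℕ} (hn : Tendsto n l atTop)
    {w : ι → ℂ} {w₀ : ℂ} (hw : Tendsto w l (𝓝 w₀)) (hw₀ : w₀.re < 0) :
    Tendsto (fun i => ∫ φ in (-θ)..θ, amplitude f a 1 lam (n i) (w i) φ *
      exp (((n i : ℝ) / lam : ℂ) * (exp (lam * φ * I) - 1) - (n i : ℝ) * φ * I)) l
      (𝓝 (∫ s : ℝ, (s * I - w₀)⁻¹ * exp (-(lam * s ^ 2 / 2)))) := by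
  have hf' : f ~[atInftyWithin (sector θ 1)]
      fun z => 1 * (z / 1) ^ a * exp ((z / 1) ^ (lam : ℂ)) := by simpa using hf
  have h1 : ‖(1 : ℂ)‖ = 1 := norm_one
  have hN : Tendsto (fun i => (n i : ℝ)) l atTop := tendsto_natCast_atTop_atTop.comp hn
  have hs : Tendsto (fun i => Real.sqrt (n i)) l atTop := Real.tendsto_sqrt_atTop.comp hN
  obtain ⟨K, hK⟩ : ∃ K : ℕ, θ < (2 * K + 1) * (Real.pi / lam) := by
    obtain ⟨K, hK⟩ := exists_nat_gt (θ / (Real.pi / lam))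
    have hp : 0 < Real.pi / lam := by positivity
    refine ⟨K, ?_⟩
    rw [div_lt_iff₀ hp] at hK
    have : (0 : ℝ) ≤ (K + 1) * (Real.pi / lam) := by positivity
    linarith
  set δ := -w₀.re / 4 with hδ
  have hδ0 : 0 < δ := by rw [hδ]; linarith
  have hgap := eventually_norm_one_add_div_sqrt_le hN hw hw₀
  obtain ⟨C, hC⟩ := exists_norm_normalized_le h1 hθ hf' (tendsto_radius hlam hn)
  -- The kernel is at most `√n/δ`, so division by `√n` makes the amplitude bounded; the factor `√n`
  -- of Laplace's method restores it.
  set h : ι → ℝ → ℂ := fun i φ => amplitude f a 1 lam (n i) (w i) φ / (Real.sqrt (n i) : ℂ) with hh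
  -- At every other peak the kernel is bounded, and the division by `√n` makes the limit zero.
  set L : ℤ → ℝ → ℂ := fun m s => if m = 0 then (s * I - w₀)⁻¹ else 0 with hL
  have hcont : ∀ᶠ i in l, Continuous (h i) := by
    filter_upwards [hgap, hs.eventually_gt_atTop 0] with i hi hi0
    refine (continuous_amplitude hfc a h1 lam _ (hi.trans_lt ?_)).div_const _
    have := div_pos hδ0 hi0
    linarith
  have hbound : ∀ᶠ i in l, ∀ φ, |φ| ≤ θ → ‖h i φ‖ ≤ C / δ := by
    filter_upwards [hgap, hs.eventually_gt_atTop 0, hC] with i hi hi0 hCi φ hφ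
    have hden : δ / Real.sqrt (n i) ≤
        ‖1 * exp (φ * I) - (1 + w i / (Real.sqrt (n i) : ℂ))‖ := by
      have := norm_sub_norm_le (1 * exp (φ * I)) (1 + w i / (Real.sqrt (n i) : ℂ))
      rw [one_mul, norm_exp_ofReal_mul_I] at this
      rw [one_mul]
      linarith
    have hd0 : 0 < δ / Real.sqrt (n i) := div_pos hδ0 hi0
    have hC0 := (norm_nonneg _).trans (hCi φ hφ)
    simp only [hh, amplitude]
    rw [norm_div, norm_mul, norm_div, norm_real, Real.norm_of_nonneg hi0.le]
    have e : ‖1 * exp (φ * I)‖ = 1 := by rw [one_mul, norm_exp_ofReal_mul_I]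
    rw [e]
    calc _ ≤ C * (1 / (δ / Real.sqrt (n i))) / Real.sqrt (n i) := by
          gcongr
          exact hCi φ hφ
      _ = C / δ := by field_simp
  have hlim : ∀ (m : ℤ) (s : ℝ), Tendsto (fun i => (Set.Icc (-θ) θ).indicator (h i)
      (peak lam m + s / Real.sqrt (n i))) l (𝓝 (L m s)) := by
    intro m s
    by_cases hm : m = 0
    · subst hm
      have hp0 : peak lam 0 = 0 := by simp [peak]
      have hsv : Tendsto (fun i => s / Real.sqrt (n i)) l (𝓝 0) := hs.const_div_atTop s
      have hmem : ∀ᶠ i in l, s / Real.sqrt (n i) ∈ Set.Icc (-θ) θ :=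
        hsv.eventually (Icc_mem_nhds (by linarith) hθ0)
      have hv : Tendsto (fun i => (s / Real.sqrt (n i) : ℝ) * I) l (𝓝 0) := by
        simpa using tendsto_exp_add_div_sqrt hN 0 s
      have hq := tendsto_normalized h1 hθ hf' (tendsto_radius hlam hn) hv (by
        filter_upwards [hmem] with i hi
        simpa using abs_le.2 hi)
      rw [mul_zero, exp_zero, mul_one] at hq
      have hX := (continuous_exp.tendsto _).comp hv
      have hsI : Tendsto (fun i => (Real.sqrt (n i) : ℂ) * ((s / Real.sqrt (n i) : ℝ) * I)) l
          (𝓝 (s * I)) := by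
        refine tendsto_const_nhds.congr' ?_
        filter_upwards [hs.eventually_gt_atTop 0] with i hi
        have : (Real.sqrt (n i) : ℂ) ≠ 0 := by exact_mod_cast hi.ne'
        push_cast
        field_simp
      have h2 := tendsto_div_sqrt hN (tendsto_mul_exp_sub_one_sub hN hsI)
      have hD : Tendsto (fun i => (Real.sqrt (n i) : ℂ) * (exp ((s / Real.sqrt (n i) : ℝ) * I) -
          (1 + w i / (Real.sqrt (n i) : ℂ)))) l (𝓝 (s * I - w₀)) := by
        have h3 := (h2.add hsI).sub hw
        rw [zero_add] at h3
        refine h3.congr' ?_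
        filter_upwards [hs.eventually_gt_atTop 0] with i hi
        have h4 : (Real.sqrt (n i) : ℂ) ≠ 0 := by exact_mod_cast hi.ne'
        have h5 : ((n i : ℝ) : ℂ) = (Real.sqrt (n i) : ℂ) ^ 2 := by
          rw [← ofReal_pow, Real.sq_sqrt (Nat.cast_nonneg _)]
        rw [h5]
        field_simp
        ring
      have hne : (s * I - w₀ : ℂ) ≠ 0 := by
        intro h0
        have := congrArg re h0
        simp at this
        linarith
      have h6 := hq.mul (hX.mul (hD.inv₀ hne))
      rw [exp_zero, one_mul, one_mul] at h6
      simp only [hL, if_true, hp0, zero_add]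
      refine h6.congr' ?_
      filter_upwards [hmem, hs.eventually_gt_atTop 0] with i hi hi0
      rw [Set.indicator_of_mem hi]
      simp only [hh, amplitude, Function.comp_apply, one_mul]
      rw [mul_inv]
      ring
    · simp only [hL, if_neg hm]
      rcases eventually_mem_or_eventually_notMem_Icc hN (θ := θ) (peak lam m) s with hmem | hmem
      · have hpt : Tendsto (fun i => peak lam m + s / Real.sqrt (n i)) l (𝓝 (peak lam m)) := by
          simpa using (hs.const_div_atTop s).const_add (peak lam m)
        -- A peak in `[-θ, θ]` with `θ < π` is in direction `1` only if `m = 0`. The trivial filter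
        -- is split off because membership is known only eventually.
        have hne : 1 * exp (peak lam m * I) ≠ 1 ∨ l = ⊥ := by
          by_contra! hcon
          obtain ⟨h2, h3⟩ := hcon
          have : l.NeBot := h3
          have h4 : peak lam m ∈ Set.Icc (-θ) θ := isClosed_Icc.mem_of_tendsto hpt hmem
          rw [one_mul, exp_eq_one_iff] at h2
          obtain ⟨k, hk⟩ := h2
          have h5 : peak lam m = k * (2 * Real.pi) := by
            have h6 : (peak lam m : ℂ) * I = ((k * (2 * Real.pi) : ℝ) : ℂ) * I := by
              rw [hk]; push_cast; ring
            exact_mod_cast mul_right_cancel₀ I_ne_zero h6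
          have hpi := Real.pi_pos
          have h7 : |peak lam m| < Real.pi := (abs_le.2 h4).trans_lt hθ
          rw [h5, abs_mul, abs_of_pos (by positivity : 0 < 2 * Real.pi)] at h7
          have h8 : |(k : ℝ)| < 1 := by nlinarith
          have h9 : k = 0 := by
            rw [← Int.cast_abs] at h8
            have : |k| < 1 := by exact_mod_cast h8
            exact Int.abs_lt_one_iff.1 this
          rw [h9] at h5
          simp only [peak, Int.cast_zero, zero_mul, div_eq_zero_iff, mul_eq_zero,
            Int.cast_eq_zero] at h5
          rcases h5 with (h5 | h5) | h5
          · rcases h5 with h5 | h5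
            · norm_num at h5
            · exact hpi.ne' h5
          · exact hm h5
          · exact hlam.ne' h5
        rcases hne with hne | hbot
        · have h2 := tendsto_div_sqrt hN (tendsto_amplitude h1 hlam hθ hf' hn hw hne hmem)
          refine h2.congr' ?_
          filter_upwards [hmem] with i hi
          rw [Set.indicator_of_mem hi]
        · rw [hbot]; exact tendsto_bot
      · refine tendsto_const_nhds.congr' ?_
        filter_upwards [hmem] with i hi
        rw [Set.indicator_of_notMem hi]
  have hmain := tendsto_laplace_interval hlam hθ0 hN hK hcont hbound hlim
  have hsum : ∀ i, ∑ j ∈ Finset.range (2 * K + 1), exp (-((n i : ℝ) * peak lam (j - K) * I)) *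
        ∫ s : ℝ, L (j - K) s * exp (-(lam * s ^ 2 / 2)) =
      ∫ s : ℝ, (s * I - w₀)⁻¹ * exp (-(lam * s ^ 2 / 2)) := by
    intro i
    rw [Finset.sum_eq_single K]
    · simp [hL, peak]
    · intro j _ hj
      have : ((j : ℤ) - K) ≠ 0 := by omega
      simp [hL, this]
    · intro hK'
      exact absurd (Finset.mem_range.2 (by omega)) hK'
  simp_rw [hsum] at hmain
  refine (tendsto_sub_nhds_zero_iff.1 hmain).congr' ?_
  filter_upwards [hs.eventually_gt_atTop 0] with i hi
  have h4 : (Real.sqrt (n i) : ℂ) ≠ 0 := by exact_mod_cast hi.ne'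
  rw [← intervalIntegral.integral_const_mul]
  refine intervalIntegral.integral_congr fun φ _ => ?_
  simp only [hh]
  field_simp

/-- The contribution of the sector about `ζ ≠ 1`. -/
theorem exists_tendsto_second_sector {f : ℂ → ℂ} (hfc : Continuous f) {A b ζ : ℂ} (hA : A ≠ 0)
    {lam θ α : ℝ} (hlam : 0 < lam) (hθ0 : 0 < θ) (hζ : ζ = exp (α * I)) (hα1 : 2 * θ < α)
    (hα2 : α < 2 * Real.pi - 2 * θ)
    (hf : f ~[atInftyWithin (sector θ ζ)]
      fun z => A * (z / ζ) ^ b * exp ((z / ζ) ^ (lam : ℂ)))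
    {ι : Type*} {l : Filter ι} [l.IsCountablyGenerated] [l.NeBot] {n : ι → ℕ}
    (hn : Tendsto n l atTop) {w : ι → ℂ} {w₀ : ℂ} (hw : Tendsto w l (𝓝 w₀)) (hw₀ : w₀.re < 0) :
    ∃ (K : ℕ) (c : ℤ → ℂ), c 0 ≠ 0 ∧ (∀ m, θ < |peak lam m| → c m = 0) ∧
    Tendsto (fun i => (Real.sqrt (n i) : ℂ) *
      (∫ φ in (-θ)..θ, amplitude f b ζ lam (n i) (w i) φ *
        exp (((n i : ℝ) / lam : ℂ) * (exp (lam * φ * I) - 1) - (n i : ℝ) * φ * I)) -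
      ∑ j ∈ Finset.range (2 * K + 1), exp (-((n i : ℝ) * peak lam (j - K) * I)) * c (j - K))
      l (𝓝 0) := by
  have hθ : θ < Real.pi := by linarith
  have h1 : ‖ζ‖ = 1 := by rw [hζ, norm_exp_ofReal_mul_I]
  have hN : Tendsto (fun i => (n i : ℝ)) l atTop := tendsto_natCast_atTop_atTop.comp hn
  have hs : Tendsto (fun i => Real.sqrt (n i)) l atTop := Real.tendsto_sqrt_atTop.comp hN
  obtain ⟨K, hK⟩ : ∃ K : ℕ, θ < (2 * K + 1) * (Real.pi / lam) := by
    obtain ⟨K, hK⟩ := exists_nat_gt (θ / (Real.pi / lam))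
    have hp : 0 < Real.pi / lam := by positivity
    refine ⟨K, ?_⟩
    rw [div_lt_iff₀ hp] at hK
    have : (0 : ℝ) ≤ (K + 1) * (Real.pi / lam) := by positivity
    linarith
  set κ := 1 - Real.cos θ with hκ
  have hκ0 : 0 < κ := by
    have := Real.cos_lt_cos_of_nonneg_of_le_pi le_rfl hθ.le hθ0
    rw [Real.cos_zero] at this
    rw [hκ]; linarith
  have hfar : ∀ φ : ℝ, |φ| ≤ θ → κ ≤ ‖ζ * exp (φ * I) - 1‖ := by
    intro φ hφ
    obtain ⟨h2, h3⟩ := abs_le.1 hφ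
    have e : ζ * exp (φ * I) = exp ((φ + α : ℝ) * I) := by
      rw [hζ, ← exp_add]; congr 1; push_cast; ring
    rw [e]
    exact one_sub_cos_le_norm_exp_sub_one hθ0 (by linarith) (by linarith)
  have hgap := eventually_norm_one_add_div_sqrt_le hN hw hw₀
  have husmall : ∀ᶠ i in l, ‖w i / (Real.sqrt (n i) : ℂ)‖ ≤ κ / 2 := by
    have := (tendsto_div_sqrt hN hw).norm
    rw [norm_zero] at this
    exact this.eventually_le_const (by positivity)
  obtain ⟨C, hC⟩ := exists_norm_normalized_le h1 hθ hf (tendsto_radius hlam hn)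
  have hcont : ∀ᶠ i in l, Continuous (amplitude f b ζ lam (n i) (w i)) := by
    filter_upwards [hgap, hs.eventually_gt_atTop 0] with i hi hi0
    refine continuous_amplitude hfc b h1 lam _ (hi.trans_lt ?_)
    have : 0 < -w₀.re / 4 / Real.sqrt (n i) := div_pos (by linarith) hi0
    linarith
  have hbound : ∀ᶠ i in l, ∀ φ, |φ| ≤ θ → ‖amplitude f b ζ lam (n i) (w i) φ‖ ≤ C * (1 / (κ / 2)) := by
    filter_upwards [husmall, hC] with i hi hCi φ hφ
    have hden : κ / 2 ≤ ‖ζ * exp (φ * I) - (1 + w i / (Real.sqrt (n i) : ℂ))‖ := by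
      have := norm_sub_norm_le (ζ * exp (φ * I) - 1) (w i / (Real.sqrt (n i) : ℂ))
      rw [sub_sub] at this
      linarith [hfar φ hφ]
    have hC0 := (norm_nonneg _).trans (hCi φ hφ)
    simp only [amplitude]
    rw [norm_mul, norm_div]
    have e : ‖ζ * exp (φ * I)‖ = 1 := by rw [norm_mul, h1, one_mul, norm_exp_ofReal_mul_I]
    rw [e]
    gcongr
    exact hCi φ hφ
  set g : ℝ → ℂ := fun p => A * exp (b * (p * I)) * (ζ * exp (p * I) / (ζ * exp (p * I) - 1))
    with hg
  -- Only two values matter later: zero for peaks outside the sector, and the explicit limit at `m =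
  -- 0`, which makes `c 0` nonzero.
  have hlim : ∀ (m : ℤ) (s : ℝ), ∃ L : ℂ, Tendsto (fun i => (Set.Icc (-θ) θ).indicator
      (amplitude f b ζ lam (n i) (w i)) (peak lam m + s / Real.sqrt (n i))) l (𝓝 L) ∧
      (θ < |peak lam m| → L = 0) ∧ (m = 0 → L = g 0) := by
    intro m s
    have hpt : Tendsto (fun i => peak lam m + s / Real.sqrt (n i)) l (𝓝 (peak lam m)) := by
      simpa using (hs.const_div_atTop s).const_add (peak lam m)
    rcases eventually_mem_or_eventually_notMem_Icc hN (θ := θ) (peak lam m) s with hmem | hmem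
    · have h4 : |peak lam m| ≤ θ := abs_le.2 (isClosed_Icc.mem_of_tendsto hpt hmem)
      have hne : ζ * exp (peak lam m * I) ≠ 1 := by
        intro h0
        have := hfar _ h4
        rw [h0, sub_self, norm_zero] at this
        linarith
      refine ⟨_, (tendsto_amplitude h1 hlam hθ hf hn hw hne hmem).congr' ?_, fun h => ?_, ?_⟩
      · filter_upwards [hmem] with i hi
        rw [Set.indicator_of_mem hi]
      · exact absurd h4 (not_le.2 h)
      · rintro rfl
        simp [hg, peak]
    · refine ⟨0, tendsto_const_nhds.congr' ?_, fun _ => rfl, ?_⟩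
      · filter_upwards [hmem] with i hi
        rw [Set.indicator_of_notMem hi]
      · rintro rfl
        exfalso
        have hp0 : peak lam 0 = 0 := by simp [peak]
        rw [hp0] at hpt
        have h5 := hpt.eventually (Icc_mem_nhds (by linarith : -θ < 0) hθ0)
        rw [hp0] at hmem
        obtain ⟨i, hi1, hi2⟩ := (h5.and hmem).exists
        exact hi2 hi1
  choose L hL hL0 hL1 using hlim
  refine ⟨K, fun m => ∫ s : ℝ, L m s * exp (-(lam * s ^ 2 / 2)), ?_, ?_,
    tendsto_laplace_interval hlam hθ0 hN hK hcont hbound hL⟩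
  · simp only [hL1 0 _ rfl]
    rw [MeasureTheory.integral_const_mul]
    refine mul_ne_zero ?_ ?_
    · have h2 : ζ - 1 ≠ 0 := by
        intro h0
        have := hfar 0 (by simpa using hθ0.le)
        rw [ofReal_zero, zero_mul, exp_zero, mul_one, h0, norm_zero] at this
        linarith
      have hζ0 : ζ ≠ 0 := by rw [hζ]; exact exp_ne_zero _
      simp only [hg, ofReal_zero, zero_mul, mul_zero, exp_zero, mul_one]
      exact mul_ne_zero hA (div_ne_zero hζ0 h2)
    · have e : ∀ s : ℝ, exp (-(lam * s ^ 2 / 2)) = exp (-(lam / 2 : ℂ) * s ^ 2) := fun s => by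
        congr 1; ring
      have hre : (0 : ℝ) < ((lam / 2 : ℂ)).re := by
        have : (lam / 2 : ℂ) = ((lam / 2 : ℝ) : ℂ) := by push_cast; rfl
        rw [this, ofReal_re]; positivity
      simp_rw [e]
      rw [integral_gaussian_complex hre]
      have hpi : (Real.pi : ℂ) ≠ 0 := by exact_mod_cast Real.pi_ne_zero
      have hlam' : (lam : ℂ) ≠ 0 := by exact_mod_cast hlam.ne'
      rw [cpow_ne_zero_iff]
      left
      exact div_ne_zero hpi (div_ne_zero hlam' two_ne_zero)
  · intro m hm
    simp only [hL0 m _ hm, zero_mul, MeasureTheory.integral_zero]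

/-- The contribution of the arcs outside both sectors. -/
theorem tendsto_complement {f : ℂ → ℂ} (a : ℂ) {ζ : ℂ} {lam μ θ α : ℝ} (hlam : 0 < lam)
    (hμ : μ < 1) (hθ0 : 0 < θ) (hζ : ζ = exp (α * I)) (hα1 : 2 * θ < α)
    (hα2 : α < 2 * Real.pi - 2 * θ)
    (hf : f =O[atInftyWithin (sector θ 1 ∪ sector θ ζ)ᶜ] fun z => Real.exp (μ * ‖z‖ ^ lam))
    {ι : Type*} {l : Filter ι} {n : ι → ℕ} (hn : Tendsto n l atTop) {w : ι → ℂ} {w₀ : ℂ}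
    (hw : Tendsto w l (𝓝 w₀)) {c d : ℝ} (hcd : c ≤ d)
    (h : ∀ φ ∈ Set.Ioo c d, φ ∈ Set.Ioo θ (α - θ) ∨ φ ∈ Set.Ioo (α + θ) (2 * Real.pi - θ)) :
    Tendsto (fun i => (radius lam (n i) : ℂ) ^ n i * ((radius lam (n i) : ℂ) ^ a)⁻¹ *
      exp (-(n i / lam)) * ∫ φ in c..d, remainderIntegrand f (n i) (radius lam (n i))
        (cornerPoint lam (n i) (w i)) φ) l (𝓝 0) := by
  have hζ1 : ‖ζ‖ = 1 := by rw [hζ, norm_exp_ofReal_mul_I]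
  have hN : Tendsto (fun i => (n i : ℝ)) l atTop := tendsto_natCast_atTop_atTop.comp hn
  obtain ⟨C, hC⟩ := hf.bound
  obtain ⟨R, hR⟩ := eventually_atInftyWithin_iff.1 hC
  set κ := 1 - Real.cos θ with hκ
  have hκ0 : 0 < κ := by
    have := Real.cos_lt_cos_of_nonneg_of_le_pi le_rfl (by linarith : θ ≤ Real.pi) hθ0
    rw [Real.cos_zero] at this
    rw [hκ]; linarith
  have husmall : ∀ᶠ i in l, ‖w i / (Real.sqrt (n i) : ℂ)‖ ≤ κ / 2 := by
    have := (tendsto_div_sqrt hN hw).norm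
    rw [norm_zero] at this
    exact this.eventually_le_const (by positivity)
  have hx : Tendsto (fun i => (n i : ℝ) / lam) l atTop := hN.atTop_div_const hlam
  -- In `x = n/λ` the normalised bound is `x^{-Re a/λ} e^{-(1-μ)x}` times a constant.
  have hdecay := ((tendsto_rpow_mul_exp_neg_mul_atTop_nhds_zero (-a.re / lam) (1 - μ)
    (by linarith)).comp hx).mul_const (|C| * (1 / (κ / 2)) * |d - c|)
  rw [zero_mul] at hdecay
  refine squeeze_zero_norm' ?_ hdecay
  filter_upwards [husmall, hn.eventually_gt_atTop 0,
    (tendsto_radius hlam hn).eventually_gt_atTop R] with i hi hi0 hiR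
  have hr := radius_pos hlam hi0
  set r := radius lam (n i) with hr_def
  have hr0 : (r : ℂ) ≠ 0 := by exact_mod_cast hr.ne'
  have hint : ‖∫ φ in c..d, remainderIntegrand f (n i) r (cornerPoint lam (n i) (w i)) φ‖ ≤
      |C| * Real.exp (μ * (n i / lam)) * (r ^ n i)⁻¹ * (1 / (κ / 2)) * |d - c| := by
    refine intervalIntegral.norm_integral_le_of_norm_le_const_ae ?_
    have hae : ∀ᵐ φ : ℝ, φ ≠ d := by
      simp [ae_iff]
    filter_upwards [hae] with φ hφd hφ
    rw [Set.uIoc_of_le hcd] at hφ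
    have hφ' := h φ ⟨hφ.1, lt_of_le_of_ne hφ.2 hφd⟩
    have hφ1 : θ < φ ∧ φ < 2 * Real.pi - θ := by
      rcases hφ' with ⟨h1, h2⟩ | ⟨h1, h2⟩
      · exact ⟨h1, by linarith⟩
      · exact ⟨by linarith, h2⟩
    have hnorm : ‖(r : ℂ) * exp (φ * I)‖ = r := by
      rw [norm_mul, norm_exp_ofReal_mul_I, mul_one, norm_real, Real.norm_of_nonneg hr.le]
    have hm1 : (r : ℂ) * exp (φ * I) ∉ sector θ 1 := by
      have := mul_exp_notMem_sector (ζ := 1) (by simp) hr hφ1.1 hφ1.2 hθ0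
      rwa [mul_one] at this
    have hm2 : (r : ℂ) * exp (φ * I) ∉ sector θ ζ := by
      rcases hφ' with ⟨h1, h2⟩ | ⟨h1, h2⟩
      · have := mul_exp_notMem_sector (φ := φ - α + 2 * Real.pi) hζ1 hr (by linarith)
          (by linarith) hθ0
        have e : (r : ℂ) * ζ * exp ((φ - α + 2 * Real.pi : ℝ) * I) = r * exp (φ * I) := by
          rw [hζ, mul_assoc, ← exp_add]
          have : (α * I + (φ - α + 2 * Real.pi : ℝ) * I : ℂ) = φ * I + 2 * Real.pi * I := by
            push_cast; ring
          rw [this, exp_add, exp_two_pi_mul_I, mul_one]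
        rwa [e] at this
      · have := mul_exp_notMem_sector (φ := φ - α) hζ1 hr (by linarith) (by linarith) hθ0
        have e : (r : ℂ) * ζ * exp ((φ - α : ℝ) * I) = r * exp (φ * I) := by
          rw [hζ, mul_assoc, ← exp_add]
          congr 2; push_cast; ring
        rwa [e] at this
    have hfb := hR ((r : ℂ) * exp (φ * I)) (by
      rintro (h1 | h1)
      · exact hm1 h1
      · exact hm2 h1) (by rwa [hnorm])
    rw [hnorm, hr_def, radius_rpow hlam, ← hr_def, Real.norm_of_nonneg (Real.exp_pos _).le] at hfb
    have hfb' : ‖f ((r : ℂ) * exp (φ * I))‖ ≤ |C| * Real.exp (μ * (n i / lam)) :=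
      hfb.trans (mul_le_mul_of_nonneg_right (le_abs_self C) (Real.exp_pos _).le)
    have hden : κ / 2 ≤ ‖exp (φ * I) - (1 + w i / (Real.sqrt (n i) : ℂ))‖ := by
      have h1 := norm_sub_norm_le (exp (φ * I) - 1) (w i / (Real.sqrt (n i) : ℂ))
      rw [sub_sub] at h1
      have h2 := one_sub_cos_le_norm_exp_sub_one hθ0 hφ1.1.le hφ1.2.le
      linarith
    rw [remainderIntegrand, norm_mul, norm_mul, norm_inv, norm_pow, hnorm, cornerPoint, ← hr_def,
      ← mul_sub, mul_div_mul_left _ _ hr0, norm_div, norm_exp_ofReal_mul_I]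
    gcongr
  have hP : ‖(r : ℂ) ^ n i * ((r : ℂ) ^ a)⁻¹ * exp (-(n i / lam))‖ =
      r ^ n i * (r ^ a.re)⁻¹ * Real.exp (-(n i / lam)) := by
    rw [norm_mul, norm_mul, norm_pow, norm_inv, norm_cpow_eq_rpow_re_of_pos hr, norm_real,
      Real.norm_of_nonneg hr.le, norm_exp]
    have e : (-(n i / lam : ℂ)) = ((-(n i / lam) : ℝ) : ℂ) := by push_cast; rfl
    rw [e, ofReal_re]
  have hra : (r ^ a.re)⁻¹ = ((n i : ℝ) / lam) ^ (-a.re / lam) := by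
    rw [← Real.rpow_neg hr.le, hr_def, radius, ← Real.rpow_mul (by positivity)]
    congr 1; ring
  have hexp : Real.exp (-(n i / lam)) * Real.exp (μ * (n i / lam)) =
      Real.exp (-(1 - μ) * (n i / lam)) := by
    rw [← Real.exp_add]; congr 1; ring
  rw [norm_mul, hP]
  calc _ ≤ r ^ n i * (r ^ a.re)⁻¹ * Real.exp (-(n i / lam)) *
        (|C| * Real.exp (μ * (n i / lam)) * (r ^ n i)⁻¹ * (1 / (κ / 2)) * |d - c|) := by
        gcongr
    _ = (r ^ a.re)⁻¹ * (Real.exp (-(n i / lam)) * Real.exp (μ * (n i / lam))) *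
        (|C| * (1 / (κ / 2)) * |d - c|) := by
        have : r ^ n i ≠ 0 := pow_ne_zero _ hr.ne'
        field_simp
    _ = _ := by
        rw [hexp, hra]; rfl

/-! ### The decomposition of the relative remainder -/

/-- Equivalence to zero means eventual vanishing, hence vanishing on an open set. By the identity
theorem `f` would vanish off `0`, against its growth in direction `1`. -/
theorem coefficient_ne_zero {f : ℂ → ℂ} {a b A : ℂ} {lam μ : ℝ} {ζ : ℂ} {θ : ℝ} (hζ : ‖ζ‖ = 1)
    (hθ0 : 0 < θ) (hθ : θ < Real.pi) (hf : HasTwoDirections f a b A lam μ ζ θ) : A ≠ 0 := by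
  rintro rfl
  have h2 := hf.second
  simp only [zero_mul] at h2
  have h3 : ∀ᶠ z in atInftyWithin (sector θ ζ), f z = 0 := isEquivalent_zero_iff_eventually_zero.1 h2
  obtain ⟨R, hR⟩ := eventually_atInftyWithin_iff.1 h3
  have hζ0 : ζ ≠ 0 := by intro h; simp [h] at hζ
  set r : ℝ := |R| + 1 with hr
  have hr0 : 0 < r := by positivity
  have hcont : Tendsto (fun v : ℂ => |v.im|) (𝓝 0) (𝓝 0) := by
    have : Continuous fun v : ℂ => |v.im| := by fun_prop
    simpa using this.tendsto 0
  have hcont2 : Tendsto (fun v : ℂ => ‖(r : ℂ) * ζ * exp v‖) (𝓝 0) (𝓝 r) := by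
    have : Continuous fun v : ℂ => ‖(r : ℂ) * ζ * exp v‖ := by fun_prop
    have := this.tendsto 0
    simpa [hζ, abs_of_pos hr0] using this
  have hzero : ∀ᶠ v in 𝓝 (0 : ℂ), f (r * ζ * exp v) = 0 := by
    filter_upwards [hcont.eventually_le_const hθ0,
      hcont2.eventually_const_lt (show R < r by rw [hr]; linarith [le_abs_self R])] with v h1 h2
    exact hR _ (mul_exp_mem_sector hζ hr0 hθ h1) h2
  have han : AnalyticOnNhd ℂ (fun v => f (r * ζ * exp v)) Set.univ := by
    have hd : Differentiable ℂ fun v => f (r * ζ * exp v) :=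
      hf.entire.comp ((differentiable_const _).mul differentiable_exp)
    exact hd.differentiableOn.analyticOnNhd isOpen_univ
  have hall : ∀ z : ℂ, z ≠ 0 → f z = 0 := by
    intro z hz
    have h4 := han.eqOn_zero_of_preconnected_of_eventuallyEq_zero isPreconnected_univ
      (Set.mem_univ 0) hzero
    have hrz : (r : ℂ) * ζ ≠ 0 := mul_ne_zero (by exact_mod_cast hr0.ne') hζ0
    have h5 := h4 (Set.mem_univ (log (z / (r * ζ))))
    simp only [exp_log (div_ne_zero hz hrz), mul_div_cancel₀ _ hrz] at h5
    simpa using h5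
  have hf1 : f ~[atInftyWithin (sector θ 1)]
      fun z => 1 * (z / 1) ^ a * exp ((z / 1) ^ (lam : ℂ)) := by simpa using hf.first
  have h6 := tendsto_normalized (by simp) hθ hf1 (tendsto_natCast_atTop_atTop (R := ℝ))
    (tendsto_const_nhds (x := (0 : ℂ))) (Eventually.of_forall fun _ => by simpa using hθ0.le)
  have h7 := h6.eventually_ne (by simp : (1 : ℂ) * exp (a * 0) ≠ 0)
  obtain ⟨m, hm, hm0⟩ := (h7.and (eventually_gt_atTop 0)).exists
  apply hm
  rw [normalized, hall _ (mul_ne_zero (mul_ne_zero (by exact_mod_cast hm0.ne') one_ne_zero)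
    (exp_ne_zero _))]
  simp

/-- The decomposition of the relative remainder into the contributions of the two sectors. -/
theorem exists_remainder_decomposition {f : ℂ → ℂ} {a b A : ℂ} {lam μ : ℝ} {ζ : ℂ} {θ : ℝ}
    (hlam : 0 < lam) (hμ : μ < 1) (hζ : ‖ζ‖ = 1) (hθ0 : 0 < θ) (hθ : θ < Real.pi)
    (hdisj : Disjoint (sector θ 1) (sector θ ζ)) (hf : HasTwoDirections f a b A lam μ ζ θ)
    {ι : Type*} {l : Filter ι} [l.IsCountablyGenerated] [l.NeBot] {n : ι → ℕ}
    (hn : Tendsto n l atTop) {w : ι → ℂ} {w₀ : ℂ} (hw : Tendsto w l (𝓝 w₀)) (hw₀ : w₀.re < 0) :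
    ∃ (Q S T : ι → ℂ) (K : ℕ) (c : ℤ → ℂ),
      Tendsto Q l (𝓝 (exp (-(lam * w₀ ^ 2 / 2)) * (2 * Real.pi : ℂ)⁻¹)) ∧
      Tendsto S l (𝓝 (∫ s : ℝ, (s * I - w₀)⁻¹ * exp (-(lam * s ^ 2 / 2)))) ∧
      c 0 ≠ 0 ∧ (∀ m, θ < |peak lam m| → c m = 0) ∧
      Tendsto (fun i => T i - ∑ j ∈ Finset.range (2 * K + 1),
        exp (-((n i : ℝ) * peak lam (j - K) * I)) * c (j - K)) l (𝓝 0) ∧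
      ∀ᶠ i in l, partialSum f (n i - 1) (cornerPoint lam (n i) (w i)) /
        f (cornerPoint lam (n i) (w i)) = 1 - Q i * (S i +
          (radius lam (n i) : ℂ) ^ b / (radius lam (n i) : ℂ) ^ a * (ζ ^ n i)⁻¹ /
            (Real.sqrt (n i) : ℂ) * T i) := by
  have hA := coefficient_ne_zero hζ hθ0 hθ hf
  obtain ⟨α, hα, hα1, hα2⟩ := exists_angle_of_disjoint hζ hθ hdisj
  have hfc := hf.entire.continuous
  have hN : Tendsto (fun i => (n i : ℝ)) l atTop := tendsto_natCast_atTop_atTop.comp hn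
  obtain ⟨hf0, hQ⟩ := tendsto_cornerPoint_pow_div hlam hθ0 hθ hf.first hn hw
  have hS := tendsto_first_sector hfc hlam hθ0 hθ hf.first hn hw hw₀
  obtain ⟨K, c, hc0, hc, hT⟩ := exists_tendsto_second_sector hfc hA hlam hθ0 hα hα1 hα2 hf.second
    hn hw hw₀
  have hR1 := tendsto_complement a hlam hμ hθ0 hα hα1 hα2 hf.otherwise hn hw
    (c := θ) (d := α - θ) (by linarith) (fun φ hφ => Or.inl hφ)
  have hR2 := tendsto_complement a hlam hμ hθ0 hα hα1 hα2 hf.otherwise hn hw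
    (c := α + θ) (d := 2 * Real.pi - θ) (by linarith) (fun φ hφ => Or.inr hφ)
  have hS' := (hS.add hR1).add hR2
  rw [add_zero, add_zero] at hS'
  refine ⟨_, _, _, K, c, hQ.mul_const _, hS', hc0, hc, hT, ?_⟩
  filter_upwards [hf0, hn.eventually_gt_atTop 0,
    eventually_norm_one_add_div_sqrt_le hN hw hw₀] with i hi hi0 hgap
  have hr := radius_pos hlam hi0
  set r := radius lam (n i) with hr_def
  set z := cornerPoint lam (n i) (w i) with hz_def
  have hr0 : (r : ℂ) ≠ 0 := by exact_mod_cast hr.ne'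
  have hra : (r : ℂ) ^ a ≠ 0 := by rw [cpow_ne_zero_iff]; exact Or.inl hr0
  have hs : 0 < Real.sqrt (n i) := Real.sqrt_pos.2 (Nat.cast_pos.2 hi0)
  have hs0 : (Real.sqrt (n i) : ℂ) ≠ 0 := by exact_mod_cast hs.ne'
  have hz : ‖z‖ < r := by
    have : 0 < -w₀.re / 4 / Real.sqrt (n i) := div_pos (by linarith) hs
    rw [hz_def, cornerPoint, ← hr_def, norm_mul, norm_real, Real.norm_of_nonneg hr.le]
    calc r * ‖1 + w i / (Real.sqrt (n i) : ℂ)‖ < r * 1 := by gcongr; linarith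
      _ = r := mul_one r
  have hcont := continuous_remainderIntegrand hfc (n i) hz
  -- Starting at `-θ`, the circle runs through the first sector, a gap, the second sector and a gap.
  have hp := partialSum_eq_sub_integral hf.entire hz hi0 (-θ)
  rw [show -θ + 2 * Real.pi = 2 * Real.pi - θ by ring] at hp
  change _ = f z - z ^ n i * ((2 * Real.pi : ℂ)⁻¹ *
    ∫ φ in (-θ)..(2 * Real.pi - θ), remainderIntegrand f (n i) r z φ) at hp
  have hii : ∀ x y, IntervalIntegrable (remainderIntegrand f (n i) r z) volume x y :=
    fun x y => hcont.intervalIntegrable x y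
  rw [← intervalIntegral.integral_add_adjacent_intervals (hii (-θ) (α + θ)) (hii _ _),
    ← intervalIntegral.integral_add_adjacent_intervals (hii (-θ) (α - θ)) (hii _ _),
    ← intervalIntegral.integral_add_adjacent_intervals (hii (-θ) θ) (hii _ _)] at hp
  set P := (r : ℂ) ^ n i * ((r : ℂ) ^ a)⁻¹ * exp (-(n i / lam)) with hP
  have hP0 : P ≠ 0 := mul_ne_zero (mul_ne_zero (pow_ne_zero _ hr0) (inv_ne_zero hra))
    (exp_ne_zero _)
  have hI1 : P * ∫ φ in (-θ)..θ, remainderIntegrand f (n i) r z φ =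
      ∫ φ in (-θ)..θ, amplitude f a 1 lam (n i) (w i) φ *
        exp (((n i : ℝ) / lam : ℂ) * (exp (lam * φ * I) - 1) - (n i : ℝ) * φ * I) := by
    rw [← intervalIntegral.integral_const_mul]
    refine intervalIntegral.integral_congr fun φ _ => ?_
    have := remainderIntegrand_eq_amplitude f a a (α := 0) (ζ := 1) (by simp) hlam hi0 (w i) φ
    rw [add_zero, ← hr_def, div_self hra, one_pow, inv_one, one_mul, one_mul] at this
    exact this
  have hI2 : P * ∫ φ in (α - θ)..(α + θ), remainderIntegrand f (n i) r z φ =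
      (r : ℂ) ^ b / (r : ℂ) ^ a * (ζ ^ n i)⁻¹ *
      ∫ φ in (-θ)..θ, amplitude f b ζ lam (n i) (w i) φ *
        exp (((n i : ℝ) / lam : ℂ) * (exp (lam * φ * I) - 1) - (n i : ℝ) * φ * I) := by
    rw [show α - θ = -θ + α by ring, show α + θ = θ + α by ring,
      ← intervalIntegral.integral_comp_add_right, ← intervalIntegral.integral_const_mul,
      ← intervalIntegral.integral_const_mul]
    exact intervalIntegral.integral_congr fun φ _ =>
      remainderIntegrand_eq_amplitude f a b hα hlam hi0 (w i) φ
  rw [hp, sub_div, div_self hi, ← hI1]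
  congr 1
  rw [mul_div_right_comm, ← mul_assoc _ _ (∫ φ in (-θ)..θ, _),
    div_mul_cancel₀ _ hs0, ← hI2]
  have hPinv : z ^ n i / f z = z ^ n i * ((r : ℂ) ^ n i)⁻¹ * (r : ℂ) ^ a * exp (n i / lam) / f z *
      P := by
    rw [hP, exp_neg]
    have := exp_ne_zero (n i / lam : ℂ)
    field_simp
  rw [hPinv]
  ring

/-! ### Size of the second contribution and exponential sums -/

/-- Since `√n = √λ r_n^{λ/2}`, the width of the peak is a power of `r_n`; this is the source of the
threshold `λ/2`. -/
theorem norm_sector_ratio {a b ζ : ℂ} {lam : ℝ} (hlam : 0 < lam) (hζ : ‖ζ‖ = 1) {n : ℕ}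
    (hn : 0 < n) :
    ‖(radius lam n : ℂ) ^ b / (radius lam n : ℂ) ^ a * (ζ ^ n)⁻¹ / (Real.sqrt n : ℂ)‖ =
      radius lam n ^ (b.re - a.re - lam / 2) / Real.sqrt lam := by
  have hr := radius_pos hlam hn
  have hs : Real.sqrt n = Real.sqrt lam * radius lam n ^ (lam / 2) := by
    have h : (n : ℝ) = lam * radius lam n ^ lam := by
      rw [radius_rpow hlam]; field_simp
    conv_lhs => rw [h]
    rw [Real.sqrt_mul hlam.le, Real.sqrt_eq_rpow (radius lam n ^ lam), ← Real.rpow_mul hr.le]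
    congr 2; ring
  rw [norm_div, norm_mul, norm_div, norm_inv, norm_pow, hζ, norm_cpow_eq_rpow_re_of_pos hr,
    norm_cpow_eq_rpow_re_of_pos hr, norm_real, Real.norm_of_nonneg (Real.sqrt_nonneg _), hs,
    Real.rpow_sub hr, Real.rpow_sub hr]
  simp only [one_pow, inv_one, mul_one]
  have := (Real.rpow_pos_of_pos hr (lam / 2)).ne'
  have := (Real.rpow_pos_of_pos hr a.re).ne'
  have := (Real.sqrt_pos.2 hlam).ne'
  field_simp

theorem tendsto_cesaro_pow {ω : ℂ} (hω : ‖ω‖ = 1) (h1 : ω ≠ 1) :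
    Tendsto (fun n : ℕ => (n : ℂ)⁻¹ * ∑ k ∈ Finset.range n, ω ^ k) atTop (𝓝 0) := by
  have hb : Tendsto (fun n : ℕ => (n : ℝ)⁻¹ * (2 / ‖ω - 1‖)) atTop (𝓝 0) := by
    simpa using (tendsto_inv_atTop_nhds_zero_nat (𝕜 := ℝ)).mul_const (2 / ‖ω - 1‖)
  refine squeeze_zero_norm (fun n => ?_) hb
  rw [geom_sum_eq h1, norm_mul, norm_inv, norm_div, norm_natCast]
  gcongr
  refine (norm_sub_le _ _).trans ?_
  rw [norm_pow, hω, norm_one]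
  norm_num

/-- An exponential sum with distinct frequencies that tends to zero has no constant term. -/
theorem eq_zero_of_tendsto_expSum {s : Finset ℕ} {ω c : ℕ → ℂ} {K : ℕ} (hK : K ∈ s)
    (hω : ∀ j ∈ s, ‖ω j‖ = 1) (hωK : ω K = 1) (hne : ∀ j ∈ s, j ≠ K → ω j = 1 → c j = 0)
    (h : Tendsto (fun n : ℕ => ∑ j ∈ s, ω j ^ n * c j) atTop (𝓝 0)) : c K = 0 := by
  have h1 := h.cesaro_smul
  have h2 : Tendsto (fun n : ℕ => ∑ j ∈ s, ((n : ℂ)⁻¹ * ∑ k ∈ Finset.range n, ω j ^ k) * c j)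
      atTop (𝓝 (∑ j ∈ s, if j = K then c j else 0)) := by
    refine tendsto_finsetSum _ fun j hj => ?_
    by_cases hjK : j = K
    · subst hjK
      simp only [if_true, hωK, one_pow, Finset.sum_const, Finset.card_range, nsmul_eq_mul, mul_one]
      refine tendsto_const_nhds.congr' ?_
      filter_upwards [eventually_gt_atTop 0] with n hn
      have : (n : ℂ) ≠ 0 := by exact_mod_cast hn.ne'
      rw [inv_mul_cancel₀ this, one_mul]
    · rw [if_neg hjK]
      by_cases hj1 : ω j = 1
      · simp [hne j hj hjK hj1]
      · simpa using (tendsto_cesaro_pow (hω j hj) hj1).mul_const (c j)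
  rw [Finset.sum_ite_eq' s K, if_pos hK] at h2
  refine tendsto_nhds_unique h2 (h1.congr fun n => ?_)
  rw [Finset.sum_comm, Complex.real_smul, Finset.mul_sum]
  refine Finset.sum_congr rfl fun j _ => ?_
  rw [← Finset.sum_mul]
  push_cast
  ring

/-! ### From joint convergence to uniform convergence -/

theorem tendstoUniformlyOn_of_tendsto_prod {F : ℕ → ℂ → ℂ} {G : ℂ → ℂ} {U : Set ℂ} (hU : IsOpen U)
    (h : ∀ w ∈ U, Tendsto (fun q : ℕ × ℂ => F q.1 q.2) (atTop ×ˢ 𝓝 w) (𝓝 (G w)))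
    {K : Set ℂ} (hK : IsCompact K) (hKU : K ⊆ U) : TendstoUniformlyOn F G atTop K := by
  refine (tendstoLocallyUniformlyOn_iff_forall_isCompact hU).1 ?_ K hKU hK
  rw [Metric.tendstoLocallyUniformlyOn_iff]
  intro ε hε w hw
  have h1 := (h w hw).eventually (Metric.closedBall_mem_nhds (G w) (show 0 < ε / 3 by positivity))
  obtain ⟨p, hp, q, hq, hpq⟩ := eventually_prod_iff.1 h1
  have hqU : {x | q x} ∩ U ∈ 𝓝 w := inter_mem hq (hU.mem_nhds hw)
  refine ⟨_, mem_nhdsWithin_of_mem_nhds hqU, ?_⟩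
  -- The oscillation of `G` near `w` is bounded by taking pointwise limits inside a closed ball, so
  -- no continuity of `G` is assumed.
  have hG : ∀ y ∈ {x | q x} ∩ U, dist (G y) (G w) ≤ ε / 3 := by
    rintro y ⟨hy1, hy2⟩
    have h2 : Tendsto (fun n => F n y) atTop (𝓝 (G y)) :=
      (h y hy2).comp (tendsto_id.prodMk (tendsto_const_nhds (x := y)))
    have h3 := Metric.isClosed_closedBall.mem_of_tendsto h2 (by
      filter_upwards [hp] with n hn
      exact hpq hn hy1)
    exact h3
  filter_upwards [hp] with n hn y hy
  have h4 : dist (F n y) (G w) ≤ ε / 3 := hpq hn hy.1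
  calc dist (G y) (F n y) ≤ dist (G y) (G w) + dist (F n y) (G w) := dist_triangle_right _ _ _
    _ < ε := by linarith [hG y hy]

end CornerLimit

/-! ### The equivalence -/

open CornerLimit in
theorem mainTheorem4 (f : ℂ → ℂ) (a b A : ℂ) (lam μ : ℝ) (ζ : ℂ) (θ : ℝ)
    (hlam : 0 < lam) (hμ : μ < 1) (hζ : ‖ζ‖ = 1) (hζ1 : ζ ≠ 1)
    (hθ : 0 < θ) (hθπ : θ < Real.pi)
    (hdisj : Disjoint (CornerLimit.sector θ 1) (CornerLimit.sector θ ζ))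
    (hf : CornerLimit.HasTwoDirections f a b A lam μ ζ θ) :
    (∀ K : Set ℂ, IsCompact K → K ⊆ {w : ℂ | w.re < 0} →
      TendstoUniformlyOn
        (fun (n : ℕ) (w : ℂ) =>
          CornerLimit.partialSum f (n - 1) (CornerLimit.cornerPoint lam n w) /
            f (CornerLimit.cornerPoint lam n w))
        (fun w : ℂ => 1 / 2 * CornerLimit.erfc (w * (Real.sqrt (lam / 2) : ℂ)))
        atTop K) ↔
    b.re - a.re < lam / 2 := by
  have hunit : ∀ x y : ℝ, ‖Complex.exp (-((x : ℂ) * y * Complex.I))‖ = 1 := fun x y => by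
    have : (-(x * y * Complex.I) : ℂ) = ((-(x * y) : ℝ) : ℂ) * Complex.I := by push_cast; ring
    rw [this, Complex.norm_exp_ofReal_mul_I]
  have hsl : 0 < Real.sqrt lam := Real.sqrt_pos.2 hlam
  constructor
  · intro h
    by_contra! hab
    have hre : ((-1 : ℂ)).re < 0 := by simp
    obtain ⟨Q, S, T, K, c, hQ, hS, hc0, hc, hT, hdec⟩ := exists_remainder_decomposition hlam hμ hζ
      hθ hθπ hdisj hf (n := id) (l := atTop) tendsto_id (w := fun _ => (-1 : ℂ)) tendsto_const_nhds
      hre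
    have hpt := (h {-1} isCompact_singleton (by simp)).tendsto_at (Set.mem_singleton _)
    rw [← one_sub_gaussian_cauchy_integral hlam hre] at hpt
    set q := Complex.exp (-(lam * (-1 : ℂ) ^ 2 / 2)) * (2 * Real.pi : ℂ)⁻¹ with hq
    have hq0 : q ≠ 0 := by
      have : (Real.pi : ℂ) ≠ 0 := by exact_mod_cast Real.pi_ne_zero
      exact mul_ne_zero (Complex.exp_ne_zero _) (inv_ne_zero (mul_ne_zero two_ne_zero this))
    rw [← mul_assoc] at hpt
    -- Solving the decomposition for the second contribution shows that it tends to zero.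
    have hρ := (((hpt.const_sub 1).congr' (show _ =ᶠ[atTop] fun n => Q n * (S n +
        (radius lam n : ℂ) ^ b / (radius lam n : ℂ) ^ a * (ζ ^ n)⁻¹ / (Real.sqrt n : ℂ) * T n) by
      filter_upwards [hdec] with n hn
      simp only [id] at hn
      rw [hn]; ring)).div hQ hq0).sub hS
    rw [sub_sub_cancel, mul_div_cancel_left₀ _ hq0, sub_self] at hρ
    -- The exponent `Re b - Re a - λ/2` is nonnegative here, so the coefficient of `T` has modulus
    -- at least `1/√λ` once `r_n ≥ 1`.
    have hT0 : Tendsto T atTop (𝓝 0) := by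
      have hb := hρ.norm.mul_const (Real.sqrt lam)
      rw [norm_zero, zero_mul] at hb
      refine squeeze_zero_norm' ?_ hb
      filter_upwards [hQ.eventually_ne hq0, eventually_gt_atTop 0,
        (tendsto_radius hlam tendsto_id).eventually_ge_atTop 1] with n hn hn0 hr1
      simp only [Pi.div_apply, mul_div_cancel_left₀ _ hn, add_sub_cancel_left]
      rw [norm_mul, norm_sector_ratio hlam hζ hn0]
      have h1 : 1 ≤ radius lam n ^ (b.re - a.re - lam / 2) :=
        Real.one_le_rpow hr1 (by linarith)
      calc ‖T n‖ = 1 * ‖T n‖ := (one_mul _).symm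
        _ ≤ radius lam n ^ (b.re - a.re - lam / 2) * ‖T n‖ := by gcongr
        _ = _ := by field_simp
    have hsum := hT0.sub hT
    simp only [sub_sub_cancel, sub_zero] at hsum
    apply hc0
    have hpi := Real.pi_pos
    have := eq_zero_of_tendsto_expSum (s := Finset.range (2 * K + 1))
      (ω := fun j => Complex.exp (-(((1 : ℝ) : ℂ) * peak lam (j - K) * Complex.I)))
      (c := fun j => c (j - K)) (K := K) (Finset.mem_range.2 (by omega)) (fun j _ => hunit _ _)
      (by simp [peak]) ?_ ?_
    · simpa using this
    · intro j _ hjK hω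
      apply hc
      -- A peak of modulus at most `θ < π` with trivial phase must be the central one, so no other
      -- term resonates with it.
      by_contra! hle
      rw [Complex.exp_eq_one_iff] at hω
      obtain ⟨k, hk⟩ := hω
      have h5 : peak lam (j - K) = -k * (2 * Real.pi) := by
        have h6 : (peak lam (j - K) : ℂ) * Complex.I =
            ((-k * (2 * Real.pi) : ℝ) : ℂ) * Complex.I := by
          push_cast at hk ⊢
          linear_combination -hk
        exact_mod_cast mul_right_cancel₀ Complex.I_ne_zero h6
      have h7 : |peak lam (j - K)| < Real.pi := hle.trans_lt hθπ
      rw [h5, abs_mul, abs_neg, abs_of_pos (by positivity : 0 < 2 * Real.pi)] at h7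
      have h8 : |(k : ℝ)| < 1 := by nlinarith
      have h9 : k = 0 := by
        rw [← Int.cast_abs] at h8
        have : |k| < 1 := by exact_mod_cast h8
        exact Int.abs_lt_one_iff.1 this
      rw [h9, Int.cast_zero, neg_zero, zero_mul, peak, div_eq_zero_iff] at h5
      rcases h5 with h5 | h5
      · have h10 : (((j : ℤ) - K : ℤ) : ℝ) = 0 := by
          rcases mul_eq_zero.1 h5 with h | h
          · linarith
          · exact h
        have h11 : (j : ℤ) - K = 0 := by exact_mod_cast h10
        omega
      · exact hlam.ne' h5
    · refine hsum.congr fun n => Finset.sum_congr rfl fun j _ => ?_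
      rw [← Complex.exp_nat_mul]
      congr 2
      simp only [id]
      push_cast
      ring
  · intro hab K hK hKU
    refine tendstoUniformlyOn_of_tendsto_prod
      (isOpen_lt Complex.continuous_re continuous_const) ?_ hK hKU
    intro w₀ hw₀
    have hw₀' : w₀.re < 0 := hw₀
    obtain ⟨Q, S, T, K, c, hQ, hS, hc0, hc, hT, hdec⟩ := exists_remainder_decomposition hlam hμ hζ
      hθ hθπ hdisj hf (n := Prod.fst) (l := atTop ×ˢ 𝓝 w₀) tendsto_fst (w := Prod.snd) tendsto_snd
      hw₀'
    rw [← one_sub_gaussian_cauchy_integral hlam hw₀', ← mul_assoc]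
    have hlim : Tendsto (fun i : ℕ × ℂ => (radius lam i.1 : ℂ) ^ b / (radius lam i.1 : ℂ) ^ a *
        (ζ ^ i.1)⁻¹ / (Real.sqrt i.1 : ℂ) * T i) (atTop ×ˢ 𝓝 w₀) (𝓝 0) := by
      have h1 : Tendsto (fun i : ℕ × ℂ => radius lam i.1 ^ (-(lam / 2 - (b.re - a.re))))
          (atTop ×ˢ 𝓝 w₀) (𝓝 0) :=
        (tendsto_rpow_neg_atTop (by linarith)).comp (tendsto_radius hlam tendsto_fst)
      have h2 := (h1.div_const (Real.sqrt lam)).mul_const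
        (1 + ∑ j ∈ Finset.range (2 * K + 1), ‖c (j - K)‖)
      rw [zero_div, zero_mul] at h2
      refine squeeze_zero_norm' ?_ h2
      have hT1 := hT.norm.eventually_le_const (show ‖(0 : ℂ)‖ < 1 by simp)
      filter_upwards [hT1, tendsto_fst.eventually (eventually_gt_atTop 0)] with i hi hi0
      rw [norm_mul, norm_sector_ratio hlam hζ hi0,
        show b.re - a.re - lam / 2 = -(lam / 2 - (b.re - a.re)) by ring]
      have hr := radius_pos hlam hi0
      gcongr
      have h3 := norm_le_norm_sub_add (T i) (∑ j ∈ Finset.range (2 * K + 1),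
        Complex.exp (-((i.1 : ℝ) * peak lam (j - K) * Complex.I)) * c (j - K))
      refine h3.trans (add_le_add hi ((norm_sum_le _ _).trans (le_of_eq ?_)))
      refine Finset.sum_congr rfl fun j _ => ?_
      rw [norm_mul, hunit, one_mul]
    have := (hQ.mul (hS.add hlim)).const_sub 1
    rw [add_zero] at this
    refine this.congr' ?_
    filter_upwards [hdec] with i hi
    exact hi.symm
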